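/- **Theorem (duality for Schur multiple zeta values of skew type).** Let $\mu\subseteq\lambda$ be partitions and $\delta=\lambda/\mu$ the skew diagram whose $j$-th column consists of the boxes $(i,j)$ with $\mu'_j<i\le\lambda'_j$ ($\lambda',\mu'$ denote conjugate partitions). A semi-standard Young tableau of shape $\delta$ is a filling $M=(m_{ij})_{(i,j)\in\delta}$ by positive integers that is weakly increasing along rows and strictly increasing down columns. For a tableau ${\pmb k}=(k_{ij})_{(i,j)\in\delta}$ of positive integers put $$\zeta_\delta({\pmb k})=\sum_{M\in \mathrm{SSYT}_\delta}\ \prod_{(i,j)\in\delta} m_{ij}^{-k_{ij}} .$$ For integers $a,b\ge1$ let $A(a,b)=(\underbrace{1,\dots,1}_{a-1},b+1)$ (an admissible piece) and $A(a,b)^\dagger=A(b,a)$. A concatenation $(A_1,\dots,A_m)$ of admissible pieces ($m\ge 0$) has the dual index $(A_m^\dagger,\dots,A_1^\dagger)$. Let $I^D_\delta$ be the set of tableaux ${\pmb k}$ of shape $\delta$ such that * $k_{ij}=k_{pq}$ whenever $j-i=q-p$; * every column, read from top to bottom, is a concatenation of admissible pieces; * if $(i,j)$ is the top box of its column and $(i,j+1)\in\delta$,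 then $k_{i,j+1}\ne1$. For ${\pmb k}\in I^D_\delta$ the dual tableau ${\pmb k}^\dagger$ is obtained by replacing each column of ${\pmb k}$, read from top to bottom, by its dual index, and arranging the duals of columns $\lambda_1,\lambda_1-1,\dots,1$ in this order from left to right, with the following vertical positions. If columns $j$ and $j+1$ of $\delta$ have a row in common, i.e. $\lambda'_{j+1}>\mu'_j$, then the top $\lambda'_{j+1}-\mu'_j-1$ entries of column $j$ agree with the bottom entries of column $j+1$ and form whole admissible pieces; if the dual index of this sequence of entries has length $c_j$, the dual of column $j+1$ (on the left) is placed so that its top $c_j+1$ entries lie in the rows of the bottom $c_j+1$ entries of the dual of column $j$ (on the right). If columns $j$ and $j+1$ have no row in common, the top of the dual of column $j+1$ is placed in the row just below the bottom of the dual of column $j$ (an empty column being treated as a column of height $0$). The shape $\delta^\dagger$ of ${\pmb k}^\dagger$ is again a skew diagram. Then for every ${\pmb k}\in I^D_\delta$ the series $\zeta_\delta({\pmb k})$ and $\zeta_{\delta^\dagger}({\pmb k}^\dagger)$ converge absolutely, and $$\zeta_{\delta}({\pmb k})=\zeta_{\delta^{\dagger}}({\pmb k}^{\dagger}).$$ 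-/

import Mathlib

/-- A skew shape `λ/μ`: two partitions, given by their Young diagrams, with `μ ⊆ λ`.
Rows and columns are numbered from `0`; `(i, j)` is the box in row `i` and column `j`. -/
structure SkewShape where
  /-- the outer partition `λ` -/
  outer : YoungDiagram
  /-- the inner partition `μ` -/
  inner : YoungDiagram
  inner_le_outer : inner ≤ outer

namespace SkewShape

/-- The boxes of `λ/μ`: those in `λ` but not in `μ`. -/
def cells (δ : SkewShape) : Finset (ℕ × ℕ) := δ.outer.cells \ δ.inner.cells

/-- The type of boxes of a skew shape. -/
abbrev Cell (δ : SkewShape) : Type := {c : ℕ × ℕ // c ∈ δ.cells}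

/-- Column `j` occupies the rows `top j ≤ i < bot j`, where `top j = μ'_j`. -/
def top (δ : SkewShape) (j : ℕ) : ℕ := δ.inner.colLen j

/-- Column `j` occupies the rows `top j ≤ i < bot j`, where `bot j = λ'_j`. -/
def bot (δ : SkewShape) (j : ℕ) : ℕ := δ.outer.colLen j

/-- The number `λ_1` of columns. -/
def numCols (δ : SkewShape) : ℕ := δ.outer.rowLen 0

theorem mem_cells (δ : SkewShape) (i j : ℕ) :
    (i, j) ∈ δ.cells ↔ δ.top j ≤ i ∧ i < δ.bot j := by
  simp only [cells, Finset.mem_sdiff, YoungDiagram.mem_cells, YoungDiagram.mem_iff_lt_colLen,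
    top, bot, not_lt]
  exact and_comm

theorem top_anti (δ : SkewShape) {a b : ℕ} (h : a ≤ b) : δ.top b ≤ δ.top a :=
  δ.inner.colLen_anti _ _ h

theorem bot_anti (δ : SkewShape) {a b : ℕ} (h : a ≤ b) : δ.bot b ≤ δ.bot a :=
  δ.outer.colLen_anti _ _ h

/-- The set `T_δ(X)` of Young tableaux of shape `δ` over `X`. -/
abbrev Tableau (δ : SkewShape) (X : Type) : Type := δ.Cell → X

/-- A tableau of positive integers is semi-standard if it is weakly increasing along the rows and
strictly increasing down the columns. -/
structure IsSemistandard {δ : SkewShape} (M : δ.Tableau ℕ) : Prop where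
  pos : ∀ c, 1 ≤ M c
  row_weak : ∀ c d : δ.Cell, c.1.1 = d.1.1 → c.1.2 ≤ d.1.2 → M c ≤ M d
  col_strict : ∀ c d : δ.Cell, c.1.2 = d.1.2 → c.1.1 < d.1.1 → M c < M d

/-- The set of semi-standard Young tableaux of shape `δ`. -/
abbrev SSYT (δ : SkewShape) : Type := {M : δ.Tableau ℕ // IsSemistandard M}

/-- The term `M^{-k} = ∏ m_{ij}^{-k_{ij}}` of the Schur multiple zeta series. -/
noncomputable def zetaTerm {δ : SkewShape} (k : δ.Tableau ℕ) (M : δ.SSYT) : ℝ :=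
  ∏ c : δ.Cell, ((M.1 c : ℝ) ^ k c)⁻¹

/-- The Schur multiple zeta value `ζ_δ(k) = ∑_{M ∈ SSYT_δ} M^{-k}`. -/
noncomputable def schurZeta {δ : SkewShape} (k : δ.Tableau ℕ) : ℝ :=
  ∑' M : δ.SSYT, zetaTerm k M

/-- The `j`-th column of a tableau, read from top to bottom. -/
def column {δ : SkewShape} {X : Type} (k : δ.Tableau X) (j : ℕ) : List X :=
  List.ofFn fun p : Fin (δ.bot j - δ.top j) =>
    k ⟨(δ.top j + p, j), (δ.mem_cells _ _).2 (by have := p.2; omega)⟩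

end SkewShape

/-- The admissible piece `A(a, b) = (1, …, 1, b + 1)` with `a - 1` ones, for `a, b ≥ 1`. -/
def admissiblePiece (p : ℕ × ℕ) : List ℕ := List.replicate (p.1 - 1) 1 ++ [p.2 + 1]

/-- The list is a (possibly empty) concatenation of admissible pieces. -/
def IsAdmissibleIndex (l : List ℕ) : Prop :=
  ∃ L : List (ℕ × ℕ), (∀ p ∈ L, 1 ≤ p.1 ∧ 1 ≤ p.2) ∧ l = L.flatMap admissiblePiece

/-- The decomposition of a list, preceded by `a - 1` ones, into admissible pieces: a piece ends at
every entry larger than `1`. -/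
def piecesAux : ℕ → List ℕ → List (ℕ × ℕ)
  | _, [] => []
  | a, x :: l => if x ≤ 1 then piecesAux (a + 1) l else (a, x - 1) :: piecesAux 1 l

/-- The parameters `(a_1, b_1), …, (a_m, b_m)` of an index `(A(a_1, b_1), …, A(a_m, b_m))`. -/
def pieces (l : List ℕ) : List (ℕ × ℕ) := piecesAux 1 l

/-- The dual index `(A(b_m, a_m), …, A(b_1, a_1))` of `(A(a_1, b_1), …, A(a_m, b_m))`. -/
def dualIndex (l : List ℕ) : List ℕ :=
  ((pieces l).reverse.map Prod.swap).flatMap admissiblePiece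

theorem piecesAux_flatMap_cons (a n b : ℕ) (hb : 1 ≤ b) (l : List ℕ) :
    piecesAux a (List.replicate n 1 ++ (b + 1) :: l) = (a + n, b) :: piecesAux 1 l := by
  induction n generalizing a with
  | zero => simp [piecesAux]; omega
  | succ n ih => simp only [List.replicate_succ, List.cons_append, piecesAux]; simp [ih]; omega

/-- `pieces` does recover the pieces of a concatenation of admissible pieces. -/
theorem pieces_flatMap (L : List (ℕ × ℕ)) (hL : ∀ p ∈ L, 1 ≤ p.1 ∧ 1 ≤ p.2) :
    pieces (L.flatMap admissiblePiece) = L := by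
  induction L with
  | nil => rfl
  | cons p L ih =>
    have hp := hL p (by simp)
    have ih := ih fun q hq => hL q (by simp [hq])
    simp only [List.flatMap_cons, admissiblePiece, List.append_assoc, List.singleton_append, pieces]
    rw [piecesAux_flatMap_cons _ _ _ hp.2]
    congr 1
    exact Prod.ext (by simp; omega) rfl

theorem piecesAux_sum (l : List ℕ) (a : ℕ) :
    ((piecesAux a l).map Prod.snd).sum = (l.map (· - 1)).sum := by
  induction l generalizing a with
  | nil => rfl
  | cons x l ih =>
    by_cases hx : x ≤ 1
    · simp [piecesAux, hx, ih]
    · simp [piecesAux, hx, ih]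

theorem piecesAux_pos (l : List ℕ) (a : ℕ) : ∀ p ∈ piecesAux a l, 1 ≤ p.2 := by
  induction l generalizing a with
  | nil => simp [piecesAux]
  | cons x l ih =>
    intro p hp
    by_cases hx : x ≤ 1
    · simp only [piecesAux, hx, if_true] at hp
      exact ih _ p hp
    · simp only [piecesAux, hx, if_false, List.mem_cons] at hp
      rcases hp with rfl | hp
      · simp; omega
      · exact ih _ p hp

theorem length_dualIndex (l : List ℕ) : (dualIndex l).length = (l.map (· - 1)).sum := by
  rw [← piecesAux_sum l 1]
  have h : ∀ L : List (ℕ × ℕ), (∀ p ∈ L, 1 ≤ p.2) →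
      ((L.map Prod.swap).flatMap admissiblePiece).length = (L.map Prod.snd).sum := by
    intro L hL
    induction L with
    | nil => rfl
    | cons p L ih =>
      have := hL p (by simp)
      have ih := ih fun q hq => hL q (by simp [hq])
      simp only [List.map_cons, List.flatMap_cons, List.length_append, ih, List.sum_cons,
        admissiblePiece, List.length_replicate, Prod.fst_swap, List.length_singleton]
      omega
  rw [dualIndex, pieces, h _ (fun p hp => piecesAux_pos l 1 p (List.mem_reverse.1 hp)), List.map_reverse,
    List.sum_reverse]

namespace SkewShape

/-- The set `I_δ^D`: tableaux that are constant along the diagonals, whose columns are composed of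
admissible pieces, and such that the entry to the right of the top entry of a column, if there is
one, is not `1`. -/
structure IsAdmissible {δ : SkewShape} (k : δ.Tableau ℕ) : Prop where
  diag : ∀ c d : δ.Cell, c.1.2 + d.1.1 = d.1.2 + c.1.1 → k c = k d
  col_admissible : ∀ j, IsAdmissibleIndex (column k j)
  right_of_top : ∀ c d : δ.Cell, c.1.1 = δ.top c.1.2 → d.1 = (c.1.1, c.1.2 + 1) → k d ≠ 1

/-- The height of the dual of column `j`. -/
def dualHeight {δ : SkewShape} (k : δ.Tableau ℕ) (j : ℕ) : ℕ := (dualIndex (column k j)).length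

/-- The number of rows which the dual of column `j + 1` (which stands on the left) shares with the
dual of column `j` (on the right).

If the columns `j` and `j + 1` of `k` have a row in common, then (by constancy on diagonals) the top
`λ'_{j+1} - μ'_j - 1` entries of column `j` are the bottom entries of column `j + 1`, and they form
the pieces `A_{i(j+1)} = A_{(i+1)j}` which both columns contain. If `e` is the row, in terms of
pieces, of the lowest piece of column `j + 1`, the top entry of `A_{e(j+1)}†` (which is the
top entry of the dual of column `j + 1`) is put beside the bottom entry of `A_{ej}†`, below
which there are, in the dual of column `j`, exactly the duals of the common pieces.

If the columns have no row in common, neither have their duals. -/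
def dualOverlap {δ : SkewShape} (k : δ.Tableau ℕ) (j : ℕ) : ℕ :=
  if δ.top j < δ.bot (j + 1) then
    (dualIndex ((column k j).take (δ.bot (j + 1) - δ.top j - 1))).length + 1
  else 0

/-- The first row of the dual of column `j`. The dual of column `0` is the rightmost one and begins
in row `0`. -/
def dualTop {δ : SkewShape} (k : δ.Tableau ℕ) : ℕ → ℕ
  | 0 => 0
  | j + 1 => dualTop k j + dualHeight k j - dualOverlap k j

theorem two_le_last {l : List ℕ} (hl : IsAdmissibleIndex l) (h : l ≠ []) :
    2 ≤ l.getLast h := by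
  obtain ⟨L, hL, rfl⟩ := hl
  rcases List.eq_nil_or_concat L with rfl | ⟨L', p, rfl⟩
  · simp at h
  · have := hL p (by simp)
    simp [admissiblePiece]; omega

theorem overlap_le_height {δ : SkewShape} {k : δ.Tableau ℕ} (hk : IsAdmissible k) (j : ℕ) :
    dualOverlap k j ≤ dualHeight k j := by
  unfold dualOverlap dualHeight
  split_ifs with h
  · set m := δ.bot (j + 1) - δ.top j - 1 with hm
    have hlen : (column k j).length = δ.bot j - δ.top j := by simp [column]
    have hb := δ.bot_anti (show j ≤ j + 1 by omega)
    have hne : column k j ≠ [] := by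
      intro h0; rw [h0] at hlen; simp at hlen; omega
    have h2 := two_le_last (hk.col_admissible j) hne
    rw [length_dualIndex, length_dualIndex]
    conv_rhs => rw [← List.take_append_drop m (column k j), List.map_append, List.sum_append]
    have hd : (column k j).drop m ≠ [] := by
      intro h0
      have := congrArg List.length h0
      simp [hlen] at this; omega
    have hmem : (column k j).getLast hne - 1 ∈ ((column k j).drop m).map (· - 1) := by
      refine List.mem_map.2 ⟨_, ?_, rfl⟩
      rw [← List.getLast_drop hd]
      exact List.getLast_mem hd
    have := List.le_sum_of_mem hmem
    omega
  · omega

theorem overlap_le_height_succ {δ : SkewShape} {k : δ.Tableau ℕ} (hk : IsAdmissible k) (j : ℕ) :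
    dualOverlap k j ≤ dualHeight k (j + 1) := by
  unfold dualOverlap dualHeight
  split_ifs with h
  · set m := δ.bot (j + 1) - δ.top j - 1 with hm
    have hb := δ.bot_anti (show j ≤ j + 1 by omega)
    have ht := δ.top_anti (show j ≤ j + 1 by omega)
    set q := δ.top j - δ.top (j + 1) with hq
    have hlen : (column k j).length = δ.bot j - δ.top j := by simp [column]
    have hlen' : (column k (j + 1)).length = δ.bot (j + 1) - δ.top (j + 1) := by simp [column]
    have hsplit : (column k j).take m = (column k (j + 1)).drop (q + 1) := by
      apply List.ext_getElem
      · simp only [List.length_take, List.length_drop, hlen, hlen']; omega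
      · intro n h1 h2
        simp only [List.length_take, hlen] at h1
        simp only [List.getElem_take, List.getElem_drop, column, List.getElem_ofFn]
        apply hk.diag
        simp only
        omega
    have hql : q < (column k (j + 1)).length := by rw [hlen']; omega
    have h2 : 1 < (column k (j + 1))[q] := by
      have hc : (δ.top j, j) ∈ δ.cells := (δ.mem_cells _ _).2 (by omega)
      have hd : (δ.top j, j + 1) ∈ δ.cells := (δ.mem_cells _ _).2 (by omega)
      have hr := hk.right_of_top ⟨_, hc⟩ ⟨_, hd⟩ rfl rfl
      have he : (column k (j + 1))[q] = k ⟨_, hd⟩ := by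
        simp only [column, List.getElem_ofFn]
        apply hk.diag
        simp only
        omega
      have hpos : ∀ x ∈ column k (j + 1), 1 ≤ x := by
        intro x hm
        obtain ⟨L, -, hL⟩ := hk.col_admissible (j + 1)
        rw [hL, List.mem_flatMap] at hm
        obtain ⟨p, -, hp⟩ := hm
        simp only [admissiblePiece, List.mem_append, List.mem_replicate, List.mem_singleton] at hp
        omega
      have := hpos _ (List.getElem_mem hql)
      omega
    rw [length_dualIndex, length_dualIndex, hsplit]
    conv_rhs => rw [← List.take_append_drop q (column k (j + 1)), List.map_append, List.sum_append,
      List.drop_eq_getElem_cons hql, List.map_cons, List.sum_cons]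
    omega
  · omega

theorem dualTop_mono {δ : SkewShape} {k : δ.Tableau ℕ} (hk : IsAdmissible k) :
    Monotone (dualTop k) := by
  refine monotone_nat_of_le_succ fun j => ?_
  have := overlap_le_height hk j
  simp only [dualTop]; omega

theorem dualBot_mono {δ : SkewShape} {k : δ.Tableau ℕ} (hk : IsAdmissible k) :
    Monotone fun j => dualTop k j + dualHeight k j := by
  refine monotone_nat_of_le_succ fun j => ?_
  have := overlap_le_height hk j
  have := overlap_le_height_succ hk j
  simp only [dualTop]; omega

/-- The Young diagram with `s` columns, the lengths of which, read from right to left, are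
`f 0, …, f (s - 1)`. -/
def diagramOfCols (s : ℕ) (f : ℕ → ℕ) (hf : Monotone f) : YoungDiagram where
  cells := (Finset.range (f (s - 1)) ×ˢ Finset.range s).filter fun c => c.1 < f (s - 1 - c.2)
  isLowerSet := by
    rintro ⟨i, d⟩ ⟨i', d'⟩ ⟨hi, hd⟩ h
    simp only [Finset.coe_filter, Finset.mem_product, Finset.mem_range, Set.mem_ofPred_eq] at h hi hd ⊢
    have := hf (show s - 1 - d ≤ s - 1 - d' by omega)
    omega

theorem mem_diagramOfCols (s : ℕ) (f : ℕ → ℕ) (hf : Monotone f) (i d : ℕ) :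
    (i, d) ∈ diagramOfCols s f hf ↔ d < s ∧ i < f (s - 1 - d) := by
  rw [← YoungDiagram.mem_cells]
  simp only [diagramOfCols, Finset.mem_filter, Finset.mem_product, Finset.mem_range]
  have := hf (show s - 1 - d ≤ s - 1 by omega)
  omega

/-- The shape `δ†` of the dual tableau: its column `d`, counted from the left, is the dual of the
column `j = λ_1 - 1 - d` of `k`, and occupies `dualHeight k j` rows from the row `dualTop k j` on. -/
def dualShape {δ : SkewShape} (k : δ.Tableau ℕ) (hk : IsAdmissible k) : SkewShape where
  outer := diagramOfCols δ.numCols (fun j => dualTop k j + dualHeight k j) (dualBot_mono hk)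
  inner := diagramOfCols δ.numCols (dualTop k) (dualTop_mono hk)
  inner_le_outer := by
    rintro ⟨i, d⟩ h
    rw [mem_diagramOfCols] at h ⊢
    exact ⟨h.1, by omega⟩

theorem mem_dualShape {δ : SkewShape} (k : δ.Tableau ℕ) (hk : IsAdmissible k) (i d : ℕ) :
    (i, d) ∈ (dualShape k hk).cells ↔ d < δ.numCols ∧ dualTop k (δ.numCols - 1 - d) ≤ i ∧
      i < dualTop k (δ.numCols - 1 - d) + dualHeight k (δ.numCols - 1 - d) := by
  simp only [cells, dualShape, Finset.mem_sdiff, YoungDiagram.mem_cells, mem_diagramOfCols]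
  omega

/-- The dual tableau `k†`: its column `d`, counted from the left, is the dual index of the column
`λ_1 - 1 - d` of `k`. -/
def dualTableau {δ : SkewShape} (k : δ.Tableau ℕ) (hk : IsAdmissible k) :
    (dualShape k hk).Tableau ℕ := fun c =>
  (dualIndex (column k (δ.numCols - 1 - c.1.2)))[c.1.1 - dualTop k (δ.numCols - 1 - c.1.2)]'(by
    have h := (mem_dualShape k hk c.1.1 c.1.2).1 c.2
    have h1 : dualHeight k (δ.numCols - 1 - c.1.2) =
      (dualIndex (column k (δ.numCols - 1 - c.1.2))).length := rfl
    omega)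

end SkewShape

/-!
The box in row `i` and column `j` lies on the diagonal `p = i - j`, and column `j` occupies an
interval of diagonals whose two ends strictly decrease with `j`. As the exponents depend on the
diagonal only, the Schur multiple zeta value is a Jacobi–Trudi determinant: its entries are the
multiple zeta values of the words of exponents read from the top of one column to the bottom of
another (`jacobi_trudi` with entries bounded by `N`, `SkewShape.hasSum_zetaTerm` in the limit).
The truncated formula is proved by removing the boxes that contain the largest entry, which form a
horizontal strip; on the side of the determinant this is an expansion by multilinearity. A
diagonal without boxes gets the weight `0`, which makes the determinant factor where consecutive
columns have no row in common.

The condition on `k` says that all tops and bottoms of columns are ends of pieces. Every word in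
the determinant is therefore admissible, and the dual tableau is built so that the words in its
determinant are the duals of these: the interval from the top of column `i` to the bottom of
column `j` becomes the interval from the top of the dual of `j` to the bottom of the dual of `i`
(`IsDualChain.exists_tendsto`, `SkewShape.IsAdmissible.isDualChain`). The two matrices are thus
obtained from each other by transposition and reversal of the order of the columns, once multiple
zeta values are known to be invariant under duality (`mzv_dualIndex`).

That invariance is proved by the connected sum method: with `K m n = m! n! / (m + n)!`, the tail
sum `f ↦ ∑_{n > m} f n / n` in one variable acts on `K` like division by the other variable, so a
word of such operators can be carried over from `m` to `n` letter by letter.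
-/

open Filter Topology
open scoped ENNReal NNReal

/-! ### Duality of multiple zeta values -/

/-- The two operators from which multiple zeta values are built: `false` is the strict tail sum `f
↦ (m ↦ ∑_{n > m} f n / n)`, and `true` is the division `f ↦ (m ↦ f m / m)`. Values are in `ℝ≥0∞`,
where `0⁻¹ = ∞`; a division at `m = 0` is never read off by a tail sum. -/
noncomputable def mzvOp : Bool → (ℕ → ℝ≥0∞) → ℕ → ℝ≥0∞
  | false, f, m => ∑' n : ℕ, ((m + n + 1 : ℕ) : ℝ≥0∞)⁻¹ * f (m + n + 1)
  | true, f, m => (m : ℝ≥0∞)⁻¹ * f m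

/-- The composite of the operators named by the letters of `w`, the last letter acting first. -/
noncomputable def mzvWord (w : List Bool) (f : ℕ → ℝ≥0∞) : ℕ → ℝ≥0∞ := w.foldr mzvOp f

/-- The word of an index: an entry `k` is one tail sum and `k - 1` further divisions, that is, a
tail sum with exponent `k`. -/
def mzvLetters (l : List ℕ) : List Bool := l.flatMap fun k => false :: List.replicate (k - 1) true

/-- The multiple zeta value `∑_{0 < m₁ < ⋯ < m_r} ∏ mᵢ ^ (-kᵢ)` of an index, in `ℝ≥0∞`. -/
noncomputable def mzv (l : List ℕ) : ℝ≥0∞ := mzvWord (mzvLetters l) 1 0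

open Nat in
/-- The connector `m! n! / (m + n)!` of the connected sum method. -/
noncomputable def connector (m n : ℕ) : ℝ≥0∞ := ENNReal.ofReal ((m ! * n ! : ℝ) / (m + n)!)

theorem connector_comm (m n : ℕ) : connector m n = connector n m := by
  unfold connector; rw [mul_comm, add_comm]

theorem connector_zero_left (n : ℕ) : connector 0 n = 1 := by
  unfold connector
  have : (n.factorial : ℝ) ≠ 0 := by positivity
  simp [div_self this]

theorem connector_one_right (m : ℕ) : connector m 1 = ENNReal.ofReal (1 / (m + 1)) := by
  unfold connector
  congr 1
  have : (m.factorial : ℝ) ≠ 0 := by positivity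
  rw [Nat.factorial_succ]; push_cast; field_simp; simp [Nat.factorial_succ, mul_comm]

open Nat in
/-- The tail sum of the connector, which telescopes because `m! (n+1)! / (m+n+1)! - (m+1)! (n+1)!
/ (m+n+2)! = (n+1) / (m+1) * ((m+1)! (n+1)! / (m+n+2)!)`. -/
theorem hasSum_connector (m n : ℕ) :
    HasSum (fun i : ℕ => (1 / (m + i + 1 : ℝ)) * (((m + i + 1)! * (n + 1)! : ℝ) / (m + i + 1 + (n + 1))!))
      ((1 / (n + 1 : ℝ)) * ((m ! * (n + 1)! : ℝ) / (m + (n + 1))!)) := by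
  set f : ℕ → ℝ := fun i => (1 / (n + 1 : ℝ)) * (((m + i)! * (n + 1)! : ℝ) / (m + i + (n + 1))!) with hf
  have hstep : ∀ i : ℕ, (1 / (m + i + 1 : ℝ)) * (((m + i + 1)! * (n + 1)! : ℝ) / (m + i + 1 + (n + 1))!)
      = f i - f (i + 1) := by
    intro i
    have h1 : m + i + 1 + (n + 1) = (m + i + (n + 1)) + 1 := by omega
    have h2 : m + (i + 1) = m + i + 1 := by omega
    simp only [hf, h2]
    rw [h1, Nat.factorial_succ (m + i), Nat.factorial_succ (m + i + (n + 1))]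
    have : ((m + i + (n + 1))! : ℝ) ≠ 0 := by positivity
    push_cast
    field_simp
    ring
  have hlim : Filter.Tendsto f Filter.atTop (nhds 0) := by
    have hb : ∀ i, f i ≤ 1 / ((i : ℝ) + 1) := by
      intro i
      have h0 : ((m + i)! * (n + 1)! : ℝ) * (m + i + 1) ≤ (m + i + (n + 1))! * (n + 1) := by
        have h3 := Nat.factorial_mul_factorial_dvd_factorial_add (m + i + 1) n
        have h4 := Nat.le_of_dvd (by positivity) h3
        have h5 : m + i + 1 + n = m + i + (n + 1) := by omega
        rw [h5, Nat.factorial_succ (m + i)] at h4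
        have h6 : ((m + i + 1 : ℝ) * (m + i)!) * n ! ≤ (m + i + (n + 1))! := by exact_mod_cast h4
        rw [Nat.factorial_succ n]; push_cast
        nlinarith
      simp only [hf]
      rw [_root_.div_mul_div_comm, div_le_div_iff₀ (by positivity) (by positivity)]
      have h7 : ((m + i)! * (n + 1)! : ℝ) * (i + 1) ≤ ((m + i)! * (n + 1)! : ℝ) * (m + i + 1) := by
        gcongr
        linarith [(Nat.cast_nonneg m : (0 : ℝ) ≤ m)]
      nlinarith
    refine squeeze_zero (fun i => by positivity) hb tendsto_one_div_add_atTop_nhds_zero_nat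
  have hs : HasSum (fun i => f i - f (i + 1)) (f 0) := by
    rw [hasSum_iff_tendsto_nat_of_nonneg]
    · simp_rw [Finset.sum_range_sub']
      simpa using tendsto_const_nhds.sub hlim
    · intro i
      rw [← hstep]; positivity
  simp_rw [hstep]
  simpa [hf] using hs

theorem tsum_inv_shift (m : ℕ) : ∑' n : ℕ, ((m + n + 1 : ℕ) : ℝ≥0∞)⁻¹ = ∞ := by
  by_contra h
  have h1 := ENNReal.summable_toReal h
  have h2 : Summable fun n : ℕ => ((n + (m + 1) : ℕ) : ℝ)⁻¹ := by
    convert h1 using 2 with n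
    rw [ENNReal.toReal_inv, ENNReal.toReal_natCast]
    congr 2; omega
  exact Real.not_summable_natCast_inv ((summable_nat_add_iff (m + 1)).1 h2)

/-- Transport: a tail sum in `m` acts on the connector like a division in `n`. At `n = 0` both
sides are `∞`. -/
theorem mzvOp_false_connector (m n : ℕ) :
    mzvOp false (fun m => connector m n) m = mzvOp true (connector m) n := by
  simp only [mzvOp]
  cases n with
  | zero =>
    simp_rw [connector_comm _ 0, connector_zero_left, mul_one]
    rw [tsum_inv_shift]; simp
  | succ n =>
    have h := hasSum_connector m n
    have hc : ∀ r : ℕ, ((r + 1 : ℕ) : ℝ≥0∞)⁻¹ = ENNReal.ofReal (1 / (r + 1 : ℝ)) := by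
      intro r
      rw [one_div, ENNReal.ofReal_inv_of_pos (by positivity)]
      congr 1
      rw [← ENNReal.ofReal_natCast]; push_cast; rfl
    simp_rw [hc, connector, ← ENNReal.ofReal_mul (show (0 : ℝ) ≤ 1 / ((n : ℝ) + 1) by positivity)]
    rw [← h.tsum_eq, ENNReal.ofReal_tsum_of_nonneg (fun i => by positivity) h.summable]
    congr 1; ext i
    rw [← ENNReal.ofReal_mul (by positivity)]
    push_cast; rfl

theorem mzvOp_true_connector (m n : ℕ) :
    mzvOp true (fun m => connector m n) m = mzvOp false (connector m) n := by
  have h := mzvOp_false_connector n m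
  have e : (fun n => connector n m) = connector m := funext fun n => connector_comm _ _
  have e' : (fun m => connector m n) = connector n := funext fun m => connector_comm _ _
  rw [e] at h; rw [e', h]

theorem mzvOp_connector (x : Bool) (m n : ℕ) :
    mzvOp x (fun m => connector m n) m = mzvOp (!x) (connector m) n := by
  cases x
  · exact mzvOp_false_connector m n
  · exact mzvOp_true_connector m n

theorem mzvOp_comm (x y : Bool) (F : ℕ → ℕ → ℝ≥0∞) (m n : ℕ) :
    mzvOp x (fun m => mzvOp y (fun n => F m n) n) m =
      mzvOp y (fun n => mzvOp x (fun m => F m n) m) n := by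
  cases x <;> cases y <;> simp only [mzvOp]
  · simp_rw [← ENNReal.tsum_mul_left]
    rw [ENNReal.tsum_comm]
    congr! 4; ring
  · simp_rw [← ENNReal.tsum_mul_left]
    congr! 2; ring
  · simp_rw [← ENNReal.tsum_mul_left]
    congr! 2; ring
  · ring

/-- Operators acting on different variables commute. -/
theorem mzvWord_mzvOp_comm (w : List Bool) (y : Bool) (F : ℕ → ℕ → ℝ≥0∞) (m n : ℕ) :
    mzvWord w (fun m => mzvOp y (fun n => F m n) n) m =
      mzvOp y (fun n => mzvWord w (fun m => F m n) m) n := by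
  induction w generalizing m n with
  | nil => rfl
  | cons x w ih =>
    change mzvOp x (mzvWord w _) m = mzvOp y (fun n => mzvOp x (mzvWord w _) m) n
    rw [← mzvOp_comm x y (fun m n => mzvWord w (fun m => F m n) m)]
    congr 1; ext m'; exact ih m' n

theorem mzvWord_append (w w' : List Bool) (f : ℕ → ℝ≥0∞) :
    mzvWord (w ++ w') f = mzvWord w (mzvWord w' f) := by
  simp [mzvWord]

/-- Transporting a whole word across the connector, one letter at a time, reverses it and
exchanges its letters. -/
theorem mzvWord_connector (w : List Bool) (m n : ℕ) :
    mzvWord w (fun m => connector m n) m = mzvWord (w.reverse.map not) (connector m) n := by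
  induction w using List.reverseRecOn generalizing m n with
  | nil => rfl
  | append_singleton w x ih =>
    rw [mzvWord_append]
    have e : mzvWord [x] (fun m => connector m n) = fun m => mzvOp (!x) (fun n => connector m n) n :=
      funext fun m => mzvOp_connector x m n
    rw [e, mzvWord_mzvOp_comm]
    simp only [List.reverse_append, List.reverse_singleton, List.singleton_append, List.map_cons]
    change _ = mzvOp (!x) (mzvWord _ _) n
    congr 1; ext n'; exact ih m n'

theorem mzvWord_dual (w : List Bool) : mzvWord (w.reverse.map not) 1 0 = mzvWord w 1 0 := by
  have h := mzvWord_connector w 0 0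
  have e : connector 0 = 1 := funext fun n => connector_zero_left n
  have e' : (fun m => connector m 0) = 1 := funext fun n => by
    rw [connector_comm, connector_zero_left]; rfl
  rw [e, e'] at h
  exact h.symm

theorem mzvLetters_flatMap (L : List (ℕ × ℕ)) (hL : ∀ p ∈ L, 1 ≤ p.1 ∧ 1 ≤ p.2) :
    mzvLetters (L.flatMap admissiblePiece) =
      L.flatMap fun p => List.replicate p.1 false ++ List.replicate p.2 true := by
  unfold mzvLetters
  rw [List.flatMap_assoc]
  refine List.flatMap_congr fun p hp => ?_
  obtain ⟨h1, h2⟩ := hL p hp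
  obtain ⟨a, ha⟩ := Nat.exists_eq_add_of_le' h1
  have : ∀ n, (List.replicate n 1).flatMap (fun k => false :: List.replicate (k - 1) true)
      = List.replicate n false := by
    intro n; induction n with
    | zero => rfl
    | succ n ih => simp only [List.replicate_succ, List.flatMap_cons, ih]; simp
  simp only [admissiblePiece, List.flatMap_append, this]
  rw [ha]
  simp [List.replicate_succ']

/-- An admissible piece `A(a, b)` has the word `false ^ a * true ^ b`, so that the dual of an
index reverses its word and exchanges the letters. -/
theorem mzvLetters_dualIndex {l : List ℕ} (hl : IsAdmissibleIndex l) :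
    mzvLetters (dualIndex l) = (mzvLetters l).reverse.map not := by
  obtain ⟨L, hL, rfl⟩ := hl
  rw [dualIndex, pieces_flatMap L hL, mzvLetters_flatMap L hL, mzvLetters_flatMap]
  · rw [List.flatMap_map, List.reverse_flatMap, List.map_flatMap]
    refine List.flatMap_congr fun p hp => ?_
    simp
  · intro p hp
    simp only [List.mem_map, List.mem_reverse] at hp
    obtain ⟨q, hq, rfl⟩ := hp
    exact ⟨(hL q hq).2, (hL q hq).1⟩

/-- The duality of multiple zeta values. -/
theorem mzv_dualIndex {l : List ℕ} (hl : IsAdmissibleIndex l) : mzv (dualIndex l) = mzv l := by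
  unfold mzv
  rw [mzvLetters_dualIndex hl, mzvWord_dual]

/-! ### Convergence and truncation of multiple zeta values -/

theorem mzvWord_replicate_append (n : ℕ) (w : List Bool) (f : ℕ → ℝ≥0∞) (m : ℕ) :
    mzvWord (List.replicate n true ++ w) f m = ((m : ℝ≥0∞)⁻¹) ^ n * mzvWord w f m := by
  induction n with
  | zero => simp
  | succ n ih =>
    rw [List.replicate_succ, List.cons_append]
    change (m : ℝ≥0∞)⁻¹ * mzvWord (List.replicate n true ++ w) f m = _
    rw [ih, pow_succ]; ring

theorem mzvWord_letters_cons {k : ℕ} (hk : 1 ≤ k) (l : List ℕ) (f : ℕ → ℝ≥0∞) (m : ℕ) :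
    mzvWord (mzvLetters (k :: l)) f m =
      ∑' n : ℕ, (((m + n + 1 : ℕ) : ℝ≥0∞)⁻¹) ^ k * mzvWord (mzvLetters l) f (m + n + 1) := by
  change mzvOp false (mzvWord (List.replicate (k - 1) true ++ mzvLetters l) f) m = _
  simp only [mzvOp]
  congr 1; ext n
  rw [mzvWord_replicate_append, ← mul_assoc, ← pow_succ', Nat.sub_add_cancel hk]

/-- The bound `f m ≤ C / (m + 1)` is stable under both operators: the function `connector · 1`,
that is `1 / (m + 1)`, is fixed by the tail sum. -/
theorem mzvOp_le_connector_one (x : Bool) {f : ℕ → ℝ≥0∞} {C : ℝ≥0∞}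
    (h : ∀ m, 1 ≤ m → f m ≤ C * connector m 1) :
    (∀ m, 1 ≤ m → mzvOp x f m ≤ C * connector m 1) ∧ (x = false → mzvOp x f 0 ≤ C * connector 0 1) := by
  have hS : ∀ m, mzvOp false f m ≤ C * connector m 1 := by
    intro m
    have h1 := mzvOp_false_connector m 1
    calc mzvOp false f m ≤ ∑' n : ℕ, ((m + n + 1 : ℕ) : ℝ≥0∞)⁻¹ * (C * connector (m + n + 1) 1) :=
          ENNReal.tsum_le_tsum fun n => mul_le_mul_right (h _ (by omega)) _
      _ = C * mzvOp false (fun m => connector m 1) m := by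
          simp only [mzvOp, ← ENNReal.tsum_mul_left]; congr! 2; ring
      _ = C * connector m 1 := by rw [h1]; simp [mzvOp]
  cases x
  · exact ⟨fun m _ => hS m, fun _ => hS 0⟩
  · refine ⟨fun m hm => ?_, by simp⟩
    have : ((m : ℝ≥0∞))⁻¹ ≤ 1 := ENNReal.inv_le_one.2 (by exact_mod_cast hm)
    calc (m : ℝ≥0∞)⁻¹ * f m ≤ 1 * (C * connector m 1) := mul_le_mul' this (h m hm)
      _ = _ := one_mul _

theorem mzvWord_le_connector_one (w : List Bool) (m : ℕ) (hm : 1 ≤ m) :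
    mzvWord (w ++ [true]) 1 m ≤ 2 * connector m 1 := by
  induction w generalizing m with
  | nil =>
    change (m : ℝ≥0∞)⁻¹ * 1 ≤ _
    have hm' : (1 : ℝ) ≤ m := by exact_mod_cast hm
    rw [connector_one_right, mul_one, ← ENNReal.ofReal_natCast m,
      ← ENNReal.ofReal_inv_of_pos (by linarith), show (2 : ℝ≥0∞) = ENNReal.ofReal 2 by simp,
      ← ENNReal.ofReal_mul (by norm_num)]
    refine ENNReal.ofReal_le_ofReal ?_
    rw [inv_eq_one_div, mul_one_div, div_le_div_iff₀ (by linarith) (by linarith)]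
    linarith
  | cons x w ih => exact (mzvOp_le_connector_one x fun m hm => ih m hm).1 m hm

/-- The multiple zeta value of an admissible index converges: its word begins with a tail sum and
ends with a division, and is therefore bounded by `2 / (m + 1)` at `m = 0`. -/
theorem mzv_ne_top {l : List ℕ} (hl : IsAdmissibleIndex l) : mzv l ≠ ∞ := by
  obtain ⟨L, hL, rfl⟩ := hl
  rcases List.eq_nil_or_concat L with rfl | ⟨L', q, hL'⟩
  · simp [mzv, mzvLetters, mzvWord]
  cases L with
  | nil => simp at hL'
  | cons p L =>
    have hq : 1 ≤ q.2 := (hL q (by rw [hL']; simp)).2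
    have hp : 1 ≤ p.1 := (hL p (by simp)).1
    obtain ⟨w, hw⟩ : ∃ w, mzvLetters ((p :: L).flatMap admissiblePiece) = false :: (w ++ [true]) := by
      have h1 := mzvLetters_flatMap _ hL
      have h2 : ∃ w', mzvLetters ((p :: L).flatMap admissiblePiece) = w' ++ [true] := by
        rw [h1, hL']
        obtain ⟨b, hb⟩ := Nat.exists_eq_add_of_le' hq
        simp only [List.flatMap_append, List.concat_eq_append, List.flatMap_singleton, hb, List.replicate_succ', ← List.append_assoc]
        exact ⟨_, rfl⟩
      have h3 : ∃ w', mzvLetters ((p :: L).flatMap admissiblePiece) = false :: w' := by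
        obtain ⟨b, hb⟩ := Nat.exists_eq_add_of_le' hp
        rw [h1, List.flatMap_cons, hb, List.replicate_succ]
        exact ⟨_, rfl⟩
      obtain ⟨w', h2⟩ := h2
      obtain ⟨w'', h3⟩ := h3
      cases w' with
      | nil => rw [h2] at h3; simp at h3
      | cons y w' =>
        rw [h2, List.cons_append, List.cons.injEq] at h3
        exact ⟨w', by rw [h2, h3.1]; rfl⟩
    unfold mzv
    rw [hw]
    refine ne_top_of_le_ne_top ?_ ((mzvOp_le_connector_one false
      fun m hm => mzvWord_le_connector_one w m hm).2 rfl)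
    rw [connector_zero_left]; simp

/-- The truncated multiple zeta value `∑_{m < m₁ < ⋯ < m_r ≤ N} ∏ mᵢ ^ (-kᵢ)`. -/
noncomputable def truncMZV (N : ℕ) : ℕ → List ℕ → ℝ≥0
  | _, [] => 1
  | m, k :: l => ∑ i ∈ Finset.Ioc m N, ((i : ℝ≥0) ^ k)⁻¹ * truncMZV N i l

theorem truncMZV_mono {N N' : ℕ} (h : N ≤ N') (l : List ℕ) (m : ℕ) :
    truncMZV N m l ≤ truncMZV N' m l := by
  induction l generalizing m with
  | nil => rfl
  | cons k l ih =>
    simp only [truncMZV]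
    refine (Finset.sum_le_sum fun i _ => mul_le_mul_right (ih i) _).trans ?_
    exact Finset.sum_le_sum_of_subset (Finset.Ioc_subset_Ioc_right h)

theorem iSup_truncMZV {l : List ℕ} (hl : ∀ k ∈ l, 1 ≤ k) (m : ℕ) :
    ⨆ N, (truncMZV N m l : ℝ≥0∞) = mzvWord (mzvLetters l) 1 m := by
  induction l generalizing m with
  | nil => simp [truncMZV, mzvLetters, mzvWord]
  | cons k l ih =>
    have ih := ih fun k hk => hl k (by simp [hk])
    rw [mzvWord_letters_cons (hl k (by simp))]
    have hcoe : ∀ N i : ℕ, ((((m + i + 1 : ℕ) : ℝ≥0) ^ k)⁻¹ * truncMZV N (m + i + 1) l : ℝ≥0) =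
        (((m + i + 1 : ℕ) : ℝ≥0∞)⁻¹) ^ k * (truncMZV N (m + i + 1) l : ℝ≥0∞) := by
      intro N i
      rw [ENNReal.coe_mul, ENNReal.coe_inv (by positivity), ENNReal.coe_pow, ENNReal.inv_pow]
      simp
    have hsum : ∀ N R : ℕ, m + R ≤ N →
        ∑ i ∈ Finset.range R, (((m + i + 1 : ℕ) : ℝ≥0) ^ k)⁻¹ * truncMZV N (m + i + 1) l ≤
          truncMZV N m (k :: l) := by
      intro N R h
      simp only [truncMZV]
      rw [← Finset.sum_image (s := Finset.range R) (g := fun i => m + i + 1)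
        (f := fun j : ℕ => ((j : ℝ≥0) ^ k)⁻¹ * truncMZV N j l)]
      · refine Finset.sum_le_sum_of_subset ?_
        intro j
        simp only [Finset.mem_image, Finset.mem_range, Finset.mem_Ioc]
        omega
      · intro a _ b _ h; simpa using h
    refine le_antisymm (iSup_le fun N => ?_) ?_
    · have : truncMZV N m (k :: l) =
          ∑ i ∈ Finset.range (N - m), (((m + i + 1 : ℕ) : ℝ≥0) ^ k)⁻¹ * truncMZV N (m + i + 1) l := by
        simp only [truncMZV]
        rw [← Finset.sum_image (s := Finset.range (N - m)) (g := fun i => m + i + 1)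
          (f := fun j : ℕ => ((j : ℝ≥0) ^ k)⁻¹ * truncMZV N j l)]
        · congr 1; ext j
          simp only [Finset.mem_image, Finset.mem_range, Finset.mem_Ioc]
          constructor
          · intro h; exact ⟨j - m - 1, by omega, by omega⟩
          · omega
        · intro a _ b _ h; simpa using h
      rw [this, ENNReal.ofNNReal_finsetSum]
      refine le_trans (Finset.sum_le_sum fun i _ => ?_) (ENNReal.sum_le_tsum (Finset.range (N - m)))
      rw [hcoe, ← ih]
      exact mul_le_mul_right (le_iSup (fun N => (truncMZV N (m + i + 1) l : ℝ≥0∞)) N) _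
    · rw [ENNReal.tsum_eq_iSup_nat]
      refine iSup_le fun R => ?_
      simp_rw [← ih, ENNReal.mul_iSup]
      rw [ENNReal.finsetSum_iSup_of_monotone]
      · refine iSup_le fun N => ?_
        refine le_iSup_of_le (max N (m + R)) ?_
        simp_rw [← hcoe]
        rw [← ENNReal.ofNNReal_finsetSum, ENNReal.coe_le_coe]
        refine le_trans (Finset.sum_le_sum fun i _ => ?_) (hsum _ R (le_max_right _ _))
        exact mul_le_mul_right (truncMZV_mono (le_max_left _ _) _ _) _
      · intro i N N' h
        exact mul_le_mul_right (ENNReal.coe_le_coe.2 (truncMZV_mono h _ _)) _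

theorem tendsto_truncMZV {l : List ℕ} (hl : IsAdmissibleIndex l) (hpos : ∀ k ∈ l, 1 ≤ k) :
    Filter.Tendsto (fun N => (truncMZV N 0 l : ℝ)) Filter.atTop (nhds (mzv l).toReal) := by
  have h := tendsto_atTop_iSup (f := fun N => (truncMZV N 0 l : ℝ≥0∞))
    fun N N' h => ENNReal.coe_le_coe.2 (truncMZV_mono h _ _)
  rw [iSup_truncMZV hpos] at h
  exact (ENNReal.tendsto_toReal (mzv_ne_top hl)).comp h

theorem truncMZV_eq_of_le {N m : ℕ} (h : N ≤ m) (k : ℕ) (l : List ℕ) :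
    truncMZV N m (k :: l) = 0 := by
  simp [truncMZV, Finset.Ioc_eq_empty_of_le h]

/-- Splitting the sum according to whether the largest summation variable is `N + 1`. -/
theorem truncMZV_succ {N m : ℕ} (h : m ≤ N) (k : ℕ) (l : List ℕ) :
    truncMZV (N + 1) m (l ++ [k]) =
      truncMZV N m (l ++ [k]) + (((N + 1 : ℕ) : ℝ≥0) ^ k)⁻¹ * truncMZV N m l := by
  induction l generalizing m with
  | nil =>
    simp only [List.nil_append, truncMZV, mul_one]
    rw [Finset.sum_Ioc_succ_top h]
  | cons x l ih =>
    simp only [List.cons_append, truncMZV]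
    rw [Finset.sum_Ioc_succ_top h]
    have : truncMZV (N + 1) (N + 1) (l ++ [k]) = 0 := by
      cases l <;> exact truncMZV_eq_of_le le_rfl _ _
    rw [this, mul_zero, add_zero, Finset.mul_sum, ← Finset.sum_add_distrib]
    refine Finset.sum_congr rfl fun i hi => ?_
    rw [ih (Finset.mem_Ioc.1 hi).2]; ring

/-! ### The truncated Jacobi–Trudi formula -/

/-- The sum `∑_{1 ≤ m_x < ⋯ < m_{y-1} ≤ N} ∏ w p m_p` over strictly increasing fillings of the
interval `x ≤ p < y`, by recursion on the largest value allowed; it is `0` if `y < x`. -/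
noncomputable def intervalSum (w : ℤ → ℕ → ℝ) : ℕ → ℤ → ℤ → ℝ
  | 0, x, y => if x = y then 1 else 0
  | N + 1, x, y => intervalSum w N x y + w (y - 1) (N + 1) * intervalSum w N x (y - 1)

theorem intervalSum_of_lt (w : ℤ → ℕ → ℝ) (N : ℕ) {x y : ℤ} (h : y < x) :
    intervalSum w N x y = 0 := by
  induction N generalizing y with
  | zero => simp [intervalSum, h.ne']
  | succ N ih => simp [intervalSum, ih h, ih (show y - 1 < x by omega)]

theorem intervalSum_self (w : ℤ → ℕ → ℝ) (N : ℕ) (x : ℤ) : intervalSum w N x x = 1 := by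
  induction N with
  | zero => simp [intervalSum]
  | succ N ih => simp [intervalSum, ih, intervalSum_of_lt w N (show x - 1 < x by omega)]

/-- The Jacobi–Trudi matrix of a skew shape whose column `j` occupies the interval `u j ≤ p < v
j`, where the box in row `i` and column `j` has the position `p = i - j` on its diagonal. -/
noncomputable def columnMatrix {s : ℕ} (w : ℤ → ℕ → ℝ) (N : ℕ) (u v : Fin s → ℤ) :
    Matrix (Fin s) (Fin s) ℝ := Matrix.of fun i j => intervalSum w N (u j) (v i)

/-- Row `i` of the matrix is the row for `N` plus a multiple of the same row with `v i` lowered by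
`1`; the determinant is expanded by multilinearity. -/
theorem det_columnMatrix_succ {s : ℕ} (w : ℤ → ℕ → ℝ) (N : ℕ) (u v : Fin s → ℤ) :
    (columnMatrix w (N + 1) u v).det = ∑ S : Finset (Fin s),
      (∏ i ∈ S, w (v i - 1) (N + 1)) *
        (columnMatrix w N u fun i => if i ∈ S then v i - 1 else v i).det := by
  have h : columnMatrix w (N + 1) u v =
      (fun i => w (v i - 1) (N + 1) • fun j => intervalSum w N (u j) (v i - 1)) +
        fun i j => intervalSum w N (u j) (v i) := by
    ext i j
    simp [columnMatrix, intervalSum]; ring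
  change Matrix.detRowAlternating (columnMatrix w (N + 1) u v) = _
  rw [h, AlternatingMap.map_add_univ]
  refine Finset.sum_congr rfl fun S _ => ?_
  have h2 : S.piecewise (fun i => w (v i - 1) (N + 1) • fun j => intervalSum w N (u j) (v i - 1))
        (fun i j => intervalSum w N (u j) (v i)) =
      S.piecewise (fun i => w (v i - 1) (N + 1) •
        fun j => intervalSum w N (u j) (if i ∈ S then v i - 1 else v i))
        (fun i j => intervalSum w N (u j) (if i ∈ S then v i - 1 else v i)) := by
    ext i j
    by_cases hi : i ∈ S <;> simp [hi]
  rw [h2]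
  exact Matrix.detRowAlternating.toMultilinearMap.map_piecewise_smul _ _ _

theorem det_columnMatrix_eq_zero_of_eq {s : ℕ} (w : ℤ → ℕ → ℝ) (N : ℕ) (u v : Fin s → ℤ)
    {i j : Fin s} (hij : i ≠ j) (h : v i = v j) : (columnMatrix w N u v).det = 0 :=
  Matrix.det_zero_of_row_eq hij (by ext; simp [columnMatrix, h])

/-- If some `v i < u i`, the rows from `i` on vanish in the columns up to `i`, and this block
includes a diagonal entry. -/
theorem det_columnMatrix_eq_zero_of_lt {s : ℕ} (w : ℤ → ℕ → ℝ) (N : ℕ) {u v : Fin s → ℤ}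
    (hu : Antitone u) (hv : Antitone v) {i : Fin s} (h : v i < u i) :
    (columnMatrix w N u v).det = 0 := by
  have hz : ∀ a b, i ≤ a → b ≤ i → columnMatrix w N u v a b = 0 := by
    intro a b ha hb
    exact intervalSum_of_lt w N ((hv ha).trans_lt (h.trans_le (hu hb)))
  rw [Matrix.twoBlockTriangular_det _ (fun b => b ≤ i)
    (fun a ha b hb => hz a b (not_le.1 ha).le hb)]
  rw [Matrix.det_eq_zero_of_row_eq_zero (⟨i, le_rfl⟩ : {b // b ≤ i}), zero_mul]
  intro b
  exact hz i b le_rfl b.2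

/-- Semi-standard tableaux with entries at most `N` of the skew shape whose column `j` occupies
the rows `μ j ≤ i < l j`. The tableau is a function of the row `i` and the column `j` that is `0`
outside the shape, so that tableaux of different shapes have the same type. -/
structure IsTruncSSYT {s : ℕ} (μ l : Fin s → ℕ) (N : ℕ) (M : ℕ → Fin s → ℕ) : Prop where
  off : ∀ i j, ¬ (μ j ≤ i ∧ i < l j) → M i j = 0
  pos : ∀ i j, μ j ≤ i → i < l j → 1 ≤ M i j
  le : ∀ i j, M i j ≤ N
  row : ∀ i j j', j ≤ j' → μ j ≤ i → i < l j → μ j' ≤ i → i < l j' → M i j ≤ M i j'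
  col : ∀ i i' j, i < i' → μ j ≤ i → i' < l j → M i j < M i' j

theorem finite_isTruncSSYT {s : ℕ} (μ l : Fin s → ℕ) (N : ℕ) :
    {M | IsTruncSSYT μ l N M}.Finite := by
  set B := ∑ j, l j
  have hB : ∀ j, l j ≤ B := fun j => Finset.single_le_sum (fun _ _ => Nat.zero_le _) (Finset.mem_univ j)
  rw [← Set.finite_coe_iff]
  refine Finite.of_injective (β := Fin B → Fin s → Fin (N + 1))
    (fun M i j => ⟨M.1 i j, Nat.lt_succ_of_le (M.2.le i j)⟩) ?_
  intro M M' h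
  ext i j
  by_cases hi : i < l j
  · have := congrFun (congrFun h ⟨i, hi.trans_le (hB j)⟩) j
    simpa using this
  · rw [M.2.off i j (fun h => hi h.2), M'.2.off i j (fun h => hi h.2)]

/-- The finite set of semi-standard tableaux with entries at most `N`. -/
noncomputable def truncSSYT {s : ℕ} (μ l : Fin s → ℕ) (N : ℕ) : Finset (ℕ → Fin s → ℕ) :=
  (finite_isTruncSSYT μ l N).toFinset

theorem mem_truncSSYT {s : ℕ} {μ l : Fin s → ℕ} {N : ℕ} {M : ℕ → Fin s → ℕ} :
    M ∈ truncSSYT μ l N ↔ IsTruncSSYT μ l N M := by simp [truncSSYT]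

/-- The weight of a tableau: each box contributes `w p m`, where `p = i - j` numbers its diagonal
and `m` is its entry. -/
noncomputable def fillWeight {s : ℕ} (w : ℤ → ℕ → ℝ) (μ l : Fin s → ℕ) (M : ℕ → Fin s → ℕ) : ℝ :=
  ∏ j, ∏ i ∈ Finset.Ico (μ j) (l j), w (i - (j : ℕ)) (M i j)

/-- The column lengths after the bottom boxes of the columns in `S` have been removed. -/
def removeBottom {s : ℕ} (l : Fin s → ℕ) (S : Finset (Fin s)) (j : Fin s) : ℕ :=
  if j ∈ S then l j - 1 else l j

open Classical in
/-- The sets of columns whose bottom boxes form a horizontal strip, so that removing them leaves a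
skew shape. -/
noncomputable def strips {s : ℕ} (μ l : Fin s → ℕ) : Finset (Finset (Fin s)) :=
  Finset.univ.filter fun S => (∀ j ∈ S, μ j < l j) ∧ Antitone (removeBottom l S)

theorem mem_strips {s : ℕ} {μ l : Fin s → ℕ} {S : Finset (Fin s)} :
    S ∈ strips μ l ↔ (∀ j ∈ S, μ j < l j) ∧ Antitone (removeBottom l S) := by simp [strips]

/-- The columns that contain the entry `N + 1`, necessarily in their bottom box, for a tableau
with entries at most `N + 1`. -/
def maxStrip {s : ℕ} (μ l : Fin s → ℕ) (N : ℕ) (M : ℕ → Fin s → ℕ) : Finset (Fin s) :=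
  Finset.univ.filter fun j => μ j < l j ∧ M (l j - 1) j = N + 1

/-- The tableau without the bottom boxes of the columns in `S`. -/
def eraseStrip {s : ℕ} (l : Fin s → ℕ) (S : Finset (Fin s)) (M : ℕ → Fin s → ℕ) :
    ℕ → Fin s → ℕ := fun i j => if j ∈ S ∧ i + 1 = l j then 0 else M i j

/-- The tableau with the entry `N + 1` added in the bottom boxes of the columns in `S`. -/
def addStrip {s : ℕ} (l : Fin s → ℕ) (N : ℕ) (S : Finset (Fin s)) (M : ℕ → Fin s → ℕ) :
    ℕ → Fin s → ℕ := fun i j => if j ∈ S ∧ i + 1 = l j then N + 1 else M i j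

section
variable {s : ℕ} {μ l : Fin s → ℕ} {N : ℕ} {M : ℕ → Fin s → ℕ} {S : Finset (Fin s)}

theorem maxStrip_mem_strips (hμ : Antitone μ) (hl : Antitone l) (hM : IsTruncSSYT μ l (N + 1) M) :
    maxStrip μ l N M ∈ strips μ l := by
  rw [mem_strips]
  refine ⟨fun j hj => ?_, fun j j' hjj => ?_⟩
  · simp only [maxStrip, Finset.mem_filter] at hj; exact hj.2.1
  · have h1 := hl hjj
    have h2 := hμ hjj
    have h3 := hM.row (l j - 1) j j' hjj
    have h4 := hM.le (l j - 1) j'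
    simp only [removeBottom, maxStrip, Finset.mem_filter, Finset.mem_univ, true_and]
    split_ifs with ha hb hb <;> try omega
    by_contra hlt
    have h5 : l j' = l j := by omega
    rw [h5] at ha h3
    exact ha ⟨by omega, by have := h3 (by omega) (by omega) (by omega) (by omega); omega⟩

theorem IsTruncSSYT.eq_max (hM : IsTruncSSYT μ l (N + 1) M) {i : ℕ} {j : Fin s}
    (h : M i j = N + 1) : j ∈ maxStrip μ l N M ∧ i + 1 = l j := by
  have hs : μ j ≤ i ∧ i < l j := by
    by_contra hc; rw [hM.off i j hc] at h; omega
  have hi : i + 1 = l j := by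
    by_contra hc
    have := hM.col i (i + 1) j (by omega) hs.1 (by omega)
    have := hM.le (i + 1) j
    omega
  refine ⟨?_, hi⟩
  simp only [maxStrip, Finset.mem_filter, Finset.mem_univ, true_and]
  rw [← hi]; exact ⟨by omega, h⟩

theorem eraseStrip_isTruncSSYT (hM : IsTruncSSYT μ l (N + 1) M) :
    IsTruncSSYT μ (removeBottom l (maxStrip μ l N M)) N (eraseStrip l (maxStrip μ l N M) M) := by
  set S := maxStrip μ l N M with hS
  have key : ∀ i j, i < removeBottom l S j ↔ i < l j ∧ ¬ (j ∈ S ∧ i + 1 = l j) := by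
    intro i j
    unfold removeBottom
    split_ifs with h
    · simp only [h, true_and]; omega
    · simp [h]
  constructor
  · intro i j h
    simp only [key] at h
    unfold eraseStrip
    split_ifs with h1
    · rfl
    · exact hM.off i j fun h2 => h ⟨h2.1, h2.2, h1⟩
  · intro i j h1 h2
    rw [key] at h2
    rw [eraseStrip, if_neg h2.2]
    exact hM.pos i j h1 h2.1
  · intro i j
    unfold eraseStrip
    split_ifs with h1
    · omega
    · exact Nat.le_of_lt_succ (lt_of_le_of_ne (hM.le i j) fun h => h1 (hM.eq_max h))
  · intro i j j' hj h1 h2 h3 h4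
    rw [key] at h2 h4
    rw [eraseStrip, eraseStrip, if_neg h2.2, if_neg h4.2]
    exact hM.row i j j' hj h1 h2.1 h3 h4.1
  · intro i i' j hi h1 h2
    rw [key] at h2
    rw [eraseStrip, eraseStrip, if_neg h2.2, if_neg (by omega)]
    exact hM.col i i' j hi h1 h2.1

theorem addStrip_isTruncSSYT (hl : Antitone l) (hS : S ∈ strips μ l)
    (hM : IsTruncSSYT μ (removeBottom l S) N M) : IsTruncSSYT μ l (N + 1) (addStrip l N S M) := by
  rw [mem_strips] at hS
  have key : ∀ i j, i < removeBottom l S j ↔ i < l j ∧ ¬ (j ∈ S ∧ i + 1 = l j) := by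
    intro i j
    unfold removeBottom
    split_ifs with h
    · simp only [h, true_and]; omega
    · simp [h]
  constructor
  · intro i j h
    unfold addStrip
    split_ifs with h1
    · have := hS.1 j h1.1; omega
    · exact hM.off i j fun h2 => h ⟨h2.1, ((key i j).1 h2.2).1⟩
  · intro i j h1 h2
    unfold addStrip
    split_ifs with h3
    · omega
    · exact hM.pos i j h1 ((key i j).2 ⟨h2, h3⟩)
  · intro i j
    unfold addStrip
    split_ifs with h1
    · rfl
    · exact (hM.le i j).trans (by omega)
  · intro i j j' hj h1 h2 h3 h4
    unfold addStrip
    split_ifs with h5 h6 h6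
    · rfl
    · have := hl hj
      have h7 : l j' = l j := by omega
      have h8 : j' ∉ S := fun h => h6 ⟨h, by omega⟩
      have h9 := hS.2 hj
      simp only [removeBottom, h5.1, h8, if_true, if_false] at h9
      omega
    · exact (hM.le i j).trans (by omega)
    · exact hM.row i j j' hj h1 ((key i j).2 ⟨h2, h5⟩) h3 ((key i j').2 ⟨h4, h6⟩)
  · intro i i' j hi h1 h2
    unfold addStrip
    rw [if_neg (show ¬ (j ∈ S ∧ i + 1 = l j) by omega)]
    split_ifs with h3
    · have := hM.le i j; omega
    · exact hM.col i i' j hi h1 ((key i' j).2 ⟨h2, h3⟩)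

theorem maxStrip_addStrip (hS : S ∈ strips μ l) (hM : IsTruncSSYT μ (removeBottom l S) N M) :
    maxStrip μ l N (addStrip l N S M) = S := by
  rw [mem_strips] at hS
  ext j
  simp only [maxStrip, Finset.mem_filter, Finset.mem_univ, true_and]
  constructor
  · rintro ⟨h1, h2⟩
    by_contra hj
    have h3 := hM.le (l j - 1) j
    simp only [addStrip, hj, false_and, if_false] at h2
    omega
  · intro hj
    have := hS.1 j hj
    refine ⟨this, ?_⟩
    rw [addStrip, if_pos ⟨hj, by omega⟩]

theorem eraseStrip_addStrip (hM : IsTruncSSYT μ (removeBottom l S) N M) :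
    eraseStrip l S (addStrip l N S M) = M := by
  ext i j
  simp only [eraseStrip, addStrip]
  split_ifs with h
  · rw [hM.off i j]
    simp only [removeBottom, h.1, if_true]; omega
  · rfl

theorem addStrip_eraseStrip :
    addStrip l N (maxStrip μ l N M) (eraseStrip l (maxStrip μ l N M) M) = M := by
  ext i j
  simp only [eraseStrip, addStrip]
  split_ifs with h
  · simp only [maxStrip, Finset.mem_filter, Finset.mem_univ, true_and] at h
    rw [← h.1.2, ← h.2]; rfl
  · rfl

theorem fillWeight_addStrip (w : ℤ → ℕ → ℝ) (hS : S ∈ strips μ l) :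
    fillWeight w μ l (addStrip l N S M) =
      (∏ j ∈ S, w ((l j : ℤ) - (j : ℕ) - 1) (N + 1)) * fillWeight w μ (removeBottom l S) M := by
  rw [mem_strips] at hS
  unfold fillWeight
  have h1 := Finset.prod_ite_mem Finset.univ S fun j => w ((l j : ℤ) - (j : ℕ) - 1) (N + 1)
  rw [Finset.univ_inter] at h1
  rw [← h1, ← Finset.prod_mul_distrib]
  refine Finset.prod_congr rfl fun j _ => ?_
  by_cases hj : j ∈ S
  · have h2 := hS.1 j hj
    obtain ⟨r, hr⟩ : ∃ r, l j = r + 1 := ⟨l j - 1, by omega⟩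
    have h3 : removeBottom l S j = r := by simp [removeBottom, hj, hr]
    rw [h3, hr, Finset.prod_Ico_succ_top (by omega), if_pos hj, mul_comm]
    congr 1
    · simp only [addStrip, hj, hr, and_self, if_true]
      congr 1; push_cast; ring
    · refine Finset.prod_congr rfl fun i hi => ?_
      have := (Finset.mem_Ico.1 hi).2
      rw [addStrip, if_neg (by omega)]
  · simp [removeBottom, addStrip, hj]

/-- Sorting tableaux by the horizontal strip of their entries `N + 1`. -/
theorem sum_truncSSYT_succ (w : ℤ → ℕ → ℝ) (hμ : Antitone μ) (hl : Antitone l) :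
    ∑ M ∈ truncSSYT μ l (N + 1), fillWeight w μ l M =
      ∑ S ∈ strips μ l, (∏ j ∈ S, w ((l j : ℤ) - (j : ℕ) - 1) (N + 1)) *
        ∑ M ∈ truncSSYT μ (removeBottom l S) N, fillWeight w μ (removeBottom l S) M := by
  simp_rw [Finset.mul_sum]
  rw [Finset.sum_sigma']
  refine Finset.sum_bij' (fun M _ => ⟨maxStrip μ l N M, eraseStrip l (maxStrip μ l N M) M⟩)
    (fun p _ => addStrip l N p.1 p.2) ?_ ?_ ?_ ?_ ?_
  · intro M hM
    rw [mem_truncSSYT] at hM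
    exact Finset.mem_sigma.2 ⟨maxStrip_mem_strips hμ hl hM, mem_truncSSYT.2 (eraseStrip_isTruncSSYT hM)⟩
  · rintro ⟨S, M⟩ h
    rw [Finset.mem_sigma, mem_truncSSYT] at h
    exact mem_truncSSYT.2 (addStrip_isTruncSSYT hl h.1 h.2)
  · intro M hM
    exact addStrip_eraseStrip
  · rintro ⟨S, M⟩ h
    rw [Finset.mem_sigma, mem_truncSSYT] at h
    simp only at h ⊢
    rw [maxStrip_addStrip h.1 h.2, eraseStrip_addStrip h.2]
  · intro M hM
    rw [mem_truncSSYT] at hM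
    conv_lhs => rw [← addStrip_eraseStrip (μ := μ) (l := l) (N := N) (M := M)]
    exact fillWeight_addStrip w (maxStrip_mem_strips hμ hl hM)

theorem jacobi_trudi_zero (w : ℤ → ℕ → ℝ) (hμ : Antitone μ) (hl : Antitone l) (hle : ∀ j, μ j ≤ l j) :
    ∑ M ∈ truncSSYT μ l 0, fillWeight w μ l M =
      (columnMatrix w 0 (fun j => (μ j : ℤ) - (j : ℕ)) (fun j => (l j : ℤ) - (j : ℕ))).det := by
  by_cases h : μ = l
  · subst h
    have h1 : truncSSYT μ μ 0 = {fun _ _ => 0} := by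
      ext M
      rw [mem_truncSSYT, Finset.mem_singleton]
      constructor
      · intro h; ext i j; exact h.off i j (by omega)
      · rintro rfl
        exact ⟨fun _ _ _ => rfl, by intros; omega, by simp, by simp, by intros; omega⟩
    have h2 : columnMatrix w 0 (fun j => (μ j : ℤ) - (j : ℕ)) (fun j => (μ j : ℤ) - (j : ℕ)) = 1 := by
      ext i j
      simp only [columnMatrix, Matrix.of_apply, intervalSum, Matrix.one_apply]
      congr 1
      rw [eq_iff_iff]
      constructor
      · intro h
        rcases lt_trichotomy i j with hij | hij | hij
        · have := hμ hij.le; have : (i : ℕ) < j := hij; omega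
        · exact hij
        · have := hμ hij.le; have : (j : ℕ) < i := hij; omega
      · rintro rfl; rfl
    rw [h1, h2]; simp [fillWeight]
  · have h1 : truncSSYT μ l 0 = ∅ := by
      rw [Finset.eq_empty_iff_forall_notMem]
      intro M hM
      rw [mem_truncSSYT] at hM
      obtain ⟨j, hj⟩ := Function.ne_iff.1 h
      have h2 := hM.pos (μ j) j le_rfl (lt_of_le_of_ne (hle j) hj)
      have h3 := hM.le (μ j) j
      omega
    rw [h1, Finset.sum_empty]
    classical
    have hex : (Finset.univ.filter fun j => μ j ≠ l j).Nonempty := by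
      obtain ⟨j, hj⟩ := Function.ne_iff.1 h
      exact ⟨j, by simpa using hj⟩
    -- The first column in which the shapes differ gives a row that vanishes.
    set i := (Finset.univ.filter fun j => μ j ≠ l j).min' hex with hi
    have hi1 : μ i ≠ l i := by
      have := Finset.min'_mem _ hex
      rw [← hi] at this; simpa using this
    have hi2 : ∀ j < i, μ j = l j := by
      intro j hj
      by_contra hne
      exact absurd (Finset.min'_le _ j (by simpa using hne)) (not_le.2 hj)
    symm
    refine Matrix.det_eq_zero_of_row_eq_zero i fun j => ?_
    simp only [columnMatrix, Matrix.of_apply, intervalSum]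
    rw [if_neg]
    intro heq
    have h4 := hle i
    rcases lt_or_ge j i with hj | hj
    · have := hi2 j hj
      have := hl hj.le
      have : (j : ℕ) < i := hj
      omega
    · have := hμ hj
      have : (i : ℕ) ≤ j := hj
      omega

end

/-- The Jacobi–Trudi formula for weights that depend on the diagonal. Both sides satisfy the same
recursion in `N`, because the subsets in the expansion of the determinant that are not horizontal
strips contribute `0`. -/
theorem jacobi_trudi {s : ℕ} {μ l : Fin s → ℕ} (w : ℤ → ℕ → ℝ) (N : ℕ) (hμ : Antitone μ)
    (hl : Antitone l) (hle : ∀ j, μ j ≤ l j) :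
    ∑ M ∈ truncSSYT μ l N, fillWeight w μ l M =
      (columnMatrix w N (fun j => (μ j : ℤ) - (j : ℕ)) (fun j => (l j : ℤ) - (j : ℕ))).det := by
  induction N generalizing l with
  | zero => exact jacobi_trudi_zero w hμ hl hle
  | succ N ih =>
    rw [sum_truncSSYT_succ w hμ hl, det_columnMatrix_succ,
      ← Finset.sum_subset (Finset.subset_univ (strips μ l))]
    · refine Finset.sum_congr rfl fun S hS => ?_
      rw [mem_strips] at hS
      rw [ih hS.2]
      · congr 3
        ext j
        unfold removeBottom
        split_ifs with hj
        · have := hS.1 j hj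
          omega
        · rfl
      · intro j
        have := hle j
        unfold removeBottom
        split_ifs with hj
        · have := hS.1 j hj; omega
        · omega
    · intro S _ hS
      rw [mem_strips] at hS
      have hu : Antitone fun j : Fin s => (μ j : ℤ) - (j : ℕ) := by
        intro a b hab
        have := hμ hab
        have : (a : ℕ) ≤ b := hab
        simp only; omega
      have hv : Antitone fun j : Fin s => if j ∈ S then (l j : ℤ) - (j : ℕ) - 1 else (l j : ℤ) - (j : ℕ) := by
        intro a b hab
        rcases hab.eq_or_lt with rfl | hlt
        · rfl
        have := hl hab
        have : (a : ℕ) < b := hlt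
        simp only; split_ifs <;> omega
      have h0 : (columnMatrix w N (fun j => (μ j : ℤ) - (j : ℕ)) fun i =>
          if i ∈ S then (l i : ℤ) - (i : ℕ) - 1 else (l i : ℤ) - (i : ℕ)).det = 0 := by
        -- Removing the boxes leaves no skew shape: either a column ends above its
        -- top, or a column becomes shorter than one to its right, and then two rows are equal.
        by_cases h1 : ∀ j ∈ S, μ j < l j
        · have h2 : ¬ Antitone (removeBottom l S) := fun h => hS ⟨h1, h⟩
          unfold Antitone at h2
          push Not at h2
          obtain ⟨a, b, hab, h3⟩ := h2
          have h4 := hl hab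
          have haS : a ∈ S := by
            by_contra ha
            simp only [removeBottom, ha, if_false] at h3
            split_ifs at h3 <;> omega
          have hbS : b ∉ S := by
            intro hb
            simp only [removeBottom, haS, hb, if_true] at h3
            omega
          simp only [removeBottom, haS, hbS, if_true, if_false] at h3
          -- the last column of `S` between `a` and `b`
          have hex : (S.filter fun c => a ≤ c ∧ c < b).Nonempty :=
            ⟨a, by simpa [haS] using lt_of_le_of_ne hab fun h => hbS (h ▸ haS)⟩
          set c := (S.filter fun c => a ≤ c ∧ c < b).max' hex with hc
          have hcm := Finset.max'_mem _ hex
          rw [← hc, Finset.mem_filter] at hcm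
          obtain ⟨hcS, hac, hcb⟩ := hcm
          have hcb' : (c : ℕ) < b := hcb
          let d : Fin s := ⟨c + 1, by omega⟩
          have hcd : c < d := Fin.lt_def.2 (by simp [d])
          have hdb : d ≤ b := Fin.le_def.2 (by simp [d]; omega)
          have hdS : d ∉ S := by
            intro hd
            rcases hdb.eq_or_lt with h | h
            · exact hbS (h ▸ hd)
            · exact absurd (Finset.le_max' _ d (by simp [hd, h, hac.trans hcd.le])) (not_le.2 hcd)
          refine det_columnMatrix_eq_zero_of_eq w N _ _ hcd.ne ?_
          have h5 := hl hac
          have h6 := hl hcd.le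
          have h7 := hl hdb
          have h8 : (d : ℕ) = c + 1 := rfl
          simp only [hcS, hdS, if_true, if_false]
          omega
        · push Not at h1
          obtain ⟨j, hj, h2⟩ := h1
          refine det_columnMatrix_eq_zero_of_lt w N hu hv (i := j) ?_
          simp only [hj, if_true]; omega
      rw [h0, mul_zero]

/-! ### Schur multiple zeta values as determinants -/

/-- The weight `m ^ (-a p)` of an entry `m` on the diagonal `p`. The value `a p = 0` marks a
diagonal without boxes, whose weight is `0`: the entries of the Jacobi–Trudi matrix that run over
such a diagonal vanish. -/
noncomputable def diagWeight (a : ℤ → ℕ) (p : ℤ) (m : ℕ) : ℝ :=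
  if a p = 0 then 0 else ((m : ℝ) ^ a p)⁻¹

namespace SkewShape

theorem top_le_bot (δ : SkewShape) (j : ℕ) : δ.top j ≤ δ.bot j := by
  by_contra h
  have h1 : (δ.bot j, j) ∈ δ.inner := YoungDiagram.mem_iff_lt_colLen.2 (not_le.1 h)
  exact lt_irrefl _ (YoungDiagram.mem_iff_lt_colLen.1 (δ.inner_le_outer h1))

/-- A tableau of shape `δ` as a function of row and column, with the value `0` outside `δ`. -/
def extend {δ : SkewShape} (s : ℕ) (M : δ.Tableau ℕ) (i : ℕ) (j : Fin s) : ℕ :=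
  if h : (i, (j : ℕ)) ∈ δ.cells then M ⟨(i, j), h⟩ else 0

theorem extend_of_mem {δ : SkewShape} {s : ℕ} (M : δ.Tableau ℕ) {i : ℕ} {j : Fin s}
    (h : (i, (j : ℕ)) ∈ δ.cells) : extend s M i j = M ⟨(i, j), h⟩ := dif_pos h

theorem extend_injective {δ : SkewShape} {s : ℕ} (hs : ∀ c ∈ δ.cells, c.2 < s) :
    Function.Injective fun M : δ.SSYT => extend s M.1 := by
  intro M M' h
  ext ⟨⟨i, j⟩, hc⟩
  have h1 := congrFun (congrFun h i) ⟨j, hs _ hc⟩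
  simp only at h1
  rwa [extend_of_mem _ hc, extend_of_mem _ hc] at h1

theorem isTruncSSYT_extend_iff {δ : SkewShape} {s : ℕ} (hs : ∀ c ∈ δ.cells, c.2 < s) (N : ℕ)
    (M : δ.SSYT) : IsTruncSSYT (fun j : Fin s => δ.top j) (fun j : Fin s => δ.bot j) N
      (extend s M.1) ↔ ∀ c, M.1 c ≤ N := by
  constructor
  · rintro h ⟨⟨i, j⟩, hc⟩
    have := h.le i ⟨j, hs _ hc⟩
    rwa [extend_of_mem _ hc] at this
  · intro h
    have mem : ∀ {i j}, δ.top j ≤ i → i < δ.bot j → (i, j) ∈ δ.cells :=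
      fun h1 h2 => (δ.mem_cells _ _).2 ⟨h1, h2⟩
    constructor
    · intro i j hij
      rw [extend, dif_neg]
      rwa [mem_cells]
    · intro i j h1 h2
      rw [extend_of_mem _ (mem h1 h2)]
      exact M.2.pos _
    · intro i j
      unfold extend
      split_ifs
      · exact h _
      · exact Nat.zero_le _
    · intro i j j' hj h1 h2 h3 h4
      rw [extend_of_mem _ (mem h1 h2), extend_of_mem _ (mem h3 h4)]
      exact M.2.row_weak _ _ rfl hj
    · intro i i' j hi h1 h2
      rw [extend_of_mem _ (mem h1 (hi.trans h2)), extend_of_mem _ (mem (h1.trans hi.le) h2)]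
      exact M.2.col_strict _ _ rfl hi

theorem mem_range_extend {δ : SkewShape} {s : ℕ} (hs : ∀ c ∈ δ.cells, c.2 < s) {N : ℕ}
    {M : ℕ → Fin s → ℕ}
    (hM : IsTruncSSYT (fun j : Fin s => δ.top j) (fun j : Fin s => δ.bot j) N M) :
    M ∈ Set.range fun M : δ.SSYT => extend s M.1 := by
  refine ⟨⟨fun c => M c.1.1 ⟨c.1.2, hs _ c.2⟩, ?_, ?_, ?_⟩, ?_⟩
  · intro c
    have := (δ.mem_cells _ _).1 c.2
    exact hM.pos _ _ this.1 this.2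
  · rintro ⟨⟨i, j⟩, hc⟩ ⟨⟨i', j'⟩, hd⟩ h1 h2
    simp only at h1 h2
    subst h1
    have h3 := (δ.mem_cells _ _).1 hc
    have h4 := (δ.mem_cells _ _).1 hd
    exact hM.row _ _ _ h2 h3.1 h3.2 h4.1 h4.2
  · rintro ⟨⟨i, j⟩, hc⟩ ⟨⟨i', j'⟩, hd⟩ h1 h2
    simp only at h1 h2
    subst h1
    have h3 := (δ.mem_cells _ _).1 hc
    have h4 := (δ.mem_cells _ _).1 hd
    exact hM.col _ _ _ h2 h3.1 h4.2
  · ext i j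
    simp only [extend]
    split_ifs with h
    · rfl
    · rw [hM.off]
      rwa [mem_cells] at h

theorem fillWeight_extend {δ : SkewShape} {s : ℕ} (hs : ∀ c ∈ δ.cells, c.2 < s)
    {k : δ.Tableau ℕ} {a : ℤ → ℕ} (ha : ∀ c : δ.Cell, k c = a ((c.1.1 : ℤ) - c.1.2))
    (hpos : ∀ c, 1 ≤ k c) (M : δ.SSYT) :
    fillWeight (diagWeight a) (fun j : Fin s => δ.top j) (fun j : Fin s => δ.bot j) (extend s M.1) =
      zetaTerm k M := by
  unfold fillWeight zetaTerm
  rw [Finset.prod_sigma']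
  symm
  refine Finset.prod_bij (fun c _ => ⟨⟨c.1.2, hs _ c.2⟩, c.1.1⟩) ?_ ?_ ?_ ?_
  · intro c _
    simpa using (δ.mem_cells _ _).1 c.2
  · rintro ⟨⟨i, j⟩, hc⟩ _ ⟨⟨i', j'⟩, hd⟩ _ h
    simp only [Sigma.mk.injEq, Fin.mk.injEq, heq_eq_eq] at h
    simp [h]
  · rintro ⟨j, i⟩ h
    simp only [Finset.mem_sigma, Finset.mem_univ, true_and, Finset.mem_Ico] at h
    exact ⟨⟨(i, j), (δ.mem_cells _ _).2 h⟩, Finset.mem_univ _, rfl⟩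
  · rintro ⟨⟨i, j⟩, hc⟩ _
    have h1 := hpos ⟨(i, j), hc⟩
    have h2 := ha ⟨(i, j), hc⟩
    simp only at h2
    rw [extend_of_mem _ hc, diagWeight, ← h2, if_neg (by omega)]

/-- If the entries of the truncated Jacobi–Trudi matrix converge, the Schur multiple zeta series
converges to the determinant of the limit. The terms are nonnegative, and the tableaux with
entries at most `N` exhaust all tableaux, so that summability needs no separate estimate. -/
theorem hasSum_zetaTerm {δ : SkewShape} {s : ℕ} (hs : ∀ c ∈ δ.cells, c.2 < s)
    {k : δ.Tableau ℕ} {a : ℤ → ℕ} (ha : ∀ c : δ.Cell, k c = a ((c.1.1 : ℤ) - c.1.2))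
    (hpos : ∀ c, 1 ≤ k c) (A : Matrix (Fin s) (Fin s) ℝ)
    (hA : ∀ i j : Fin s, Tendsto (fun N => intervalSum (diagWeight a) N ((δ.top j : ℤ) - (j : ℕ))
      ((δ.bot i : ℤ) - (i : ℕ))) atTop (𝓝 (A i j))) :
    HasSum (zetaTerm k) A.det := by
  set μ : Fin s → ℕ := fun j => δ.top j with hμ
  set l : Fin s → ℕ := fun j => δ.bot j with hl
  let B : ℕ → Finset δ.SSYT := fun N =>
    (truncSSYT μ l N).preimage (fun M : δ.SSYT => extend s M.1) (extend_injective hs).injOn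
  have hB : ∀ N M, M ∈ B N ↔ ∀ c, M.1 c ≤ N := by
    intro N M
    rw [Finset.mem_preimage, mem_truncSSYT, isTruncSSYT_extend_iff hs]
  have hsum : ∀ N, ∑ M ∈ B N, zetaTerm k M =
      (columnMatrix (diagWeight a) N (fun j => (μ j : ℤ) - (j : ℕ)) (fun j => (l j : ℤ) - (j : ℕ))).det := by
    intro N
    rw [← jacobi_trudi _ N (fun _ _ h => δ.top_anti h) (fun _ _ h => δ.bot_anti h)
      (fun j => δ.top_le_bot j), ← Finset.sum_preimage (fun M : δ.SSYT => extend s M.1) _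
        (extend_injective hs).injOn]
    · exact Finset.sum_congr rfl fun M _ => (fillWeight_extend hs ha hpos M).symm
    · intro M hM h
      exact absurd (mem_range_extend hs (mem_truncSSYT.1 hM)) h
  have hlim : Tendsto (fun N => ∑ M ∈ B N, zetaTerm k M) atTop (𝓝 A.det) := by
    simp_rw [hsum]
    have : Continuous fun X : Matrix (Fin s) (Fin s) ℝ => X.det := continuous_id.matrix_det
    refine (this.tendsto A).comp ?_
    exact tendsto_pi_nhds.2 fun i => tendsto_pi_nhds.2 fun j => hA i j
  have hmono : Monotone B := by
    intro N N' h M hM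
    rw [hB] at hM ⊢
    exact fun c => (hM c).trans h
  have hB' : Tendsto B atTop atTop := by
    refine tendsto_atTop_finset_of_monotone hmono fun M => ⟨∑ c, M.1 c, ?_⟩
    rw [hB]
    exact fun c => Finset.single_le_sum (fun _ _ => Nat.zero_le _) (Finset.mem_univ c)
  have hnn : ∀ M : δ.SSYT, 0 ≤ zetaTerm k M := fun M => Finset.prod_nonneg fun c _ => by positivity
  have hsm : Summable (zetaTerm k) := by
    refine summable_of_sum_le hnn (c := A.det) fun F => ?_
    obtain ⟨N, hN⟩ := (hB'.eventually (eventually_ge_atTop F)).exists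
    refine (Finset.sum_le_sum_of_subset_of_nonneg hN fun M _ _ => hnn M).trans ?_
    refine Monotone.ge_of_tendsto (fun N N' h => ?_) hlim N
    exact Finset.sum_le_sum_of_subset_of_nonneg (hmono h) fun M _ _ => hnn M
  have h := hsm.hasSum
  rwa [tendsto_nhds_unique (h.comp hB') hlim] at h

/-- A tableau that is constant along the diagonals is given by a function of `i - j`, which may be
taken to vanish on the diagonals without boxes. -/
theorem exists_diagonal_function {δ : SkewShape} {k : δ.Tableau ℕ}
    (hk : ∀ c d : δ.Cell, c.1.2 + d.1.1 = d.1.2 + c.1.1 → k c = k d) :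
    ∃ a : ℤ → ℕ, (∀ c : δ.Cell, k c = a ((c.1.1 : ℤ) - c.1.2)) ∧
      ∀ p, (∀ c : δ.Cell, (c.1.1 : ℤ) - c.1.2 ≠ p) → a p = 0 := by
  classical
  refine ⟨fun p => if h : ∃ c : δ.Cell, (c.1.1 : ℤ) - c.1.2 = p then k h.choose else 0, ?_, ?_⟩
  · intro c
    have h : ∃ d : δ.Cell, (d.1.1 : ℤ) - d.1.2 = (c.1.1 : ℤ) - c.1.2 := ⟨c, rfl⟩
    simp only [dif_pos h]
    apply hk
    have := h.choose_spec
    omega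
  · intro p hp
    exact dif_neg fun ⟨c, hc⟩ => hp c hc

end SkewShape

/-- The list of the values of `a` on the interval `x ≤ p < y`. -/
def intervalWord (a : ℤ → ℕ) (x y : ℤ) : List ℕ := (List.range (y - x).toNat).map fun n : ℕ => a (x + n)

theorem length_intervalWord (a : ℤ → ℕ) (x y : ℤ) : (intervalWord a x y).length = (y - x).toNat := by
  simp [intervalWord]

theorem intervalWord_of_le (a : ℤ → ℕ) {x y : ℤ} (h : y ≤ x) : intervalWord a x y = [] := by
  simp [intervalWord, Int.toNat_of_nonpos (show y - x ≤ 0 by omega)]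

theorem mem_intervalWord {a : ℤ → ℕ} {x y : ℤ} {m : ℕ} :
    m ∈ intervalWord a x y ↔ ∃ p, x ≤ p ∧ p < y ∧ a p = m := by
  simp only [intervalWord, List.mem_map, List.mem_range]
  constructor
  · rintro ⟨n, hn, rfl⟩
    exact ⟨x + n, by omega, by omega, rfl⟩
  · rintro ⟨p, h1, h2, rfl⟩
    exact ⟨(p - x).toNat, by omega, by congr 1; omega⟩

theorem intervalWord_append (a : ℤ → ℕ) {x y z : ℤ} (h1 : x ≤ y) (h2 : y ≤ z) :
    intervalWord a x y ++ intervalWord a y z = intervalWord a x z := by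
  unfold intervalWord
  have : (z - x).toNat = (y - x).toNat + (z - y).toNat := by omega
  rw [this, List.range_add, List.map_append, List.map_map]
  congr 1
  refine List.map_congr_left fun n _ => ?_
  simp only [Function.comp]
  congr 1; push_cast; omega

theorem intervalWord_succ (a : ℤ → ℕ) {x y : ℤ} (h : x < y) :
    intervalWord a x y = intervalWord a x (y - 1) ++ [a (y - 1)] := by
  rw [← intervalWord_append a (show x ≤ y - 1 by omega) (show y - 1 ≤ y by omega)]
  simp [intervalWord]

theorem intervalWord_eq_append {a : ℤ → ℕ} {x z : ℤ} {l₁ l₂ : List ℕ} (h : intervalWord a x z = l₁ ++ l₂) {y : ℤ}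
    (hxy : x ≤ y) (hyz : y ≤ z) (hy : y = x + l₁.length ∨ y = z - l₂.length) :
    l₁ = intervalWord a x y ∧ l₂ = intervalWord a y z := by
  have hl := congrArg List.length h
  rw [length_intervalWord, List.length_append] at hl
  rw [← intervalWord_append a hxy hyz] at h
  have := List.append_inj h.symm (by rw [length_intervalWord]; omega)
  exact this

theorem intervalSum_eq_truncMZV {a : ℤ → ℕ} {x y : ℤ} (hxy : x ≤ y)
    (ha : ∀ p, x ≤ p → p < y → 1 ≤ a p) (N : ℕ) :
    intervalSum (diagWeight a) N x y = truncMZV N 0 (intervalWord a x y) := by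
  induction N generalizing y with
  | zero =>
    rcases hxy.eq_or_lt with rfl | hlt
    · rw [intervalWord_of_le a le_rfl]; simp [intervalSum, truncMZV]
    · have : intervalWord a x y ≠ [] := by
        intro h
        have := congrArg List.length h
        rw [length_intervalWord, List.length_nil] at this; omega
      obtain ⟨k, l, hl⟩ := List.exists_cons_of_ne_nil this
      rw [hl, truncMZV_eq_of_le le_rfl]
      simp [intervalSum, hlt.ne]
  | succ N ih =>
    rcases hxy.eq_or_lt with rfl | hlt
    · rw [intervalSum_self, intervalWord_of_le a le_rfl]; simp [truncMZV]
    · rw [intervalSum, ih hxy ha, ih (show x ≤ y - 1 by omega) fun p h1 h2 => ha p h1 (by omega),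
        intervalWord_succ a hlt, truncMZV_succ (Nat.zero_le N), diagWeight,
        if_neg (by have := ha (y - 1) (by omega) (by omega); omega)]
      push_cast; rfl

theorem intervalSum_eq_zero {a : ℤ → ℕ} {x y p : ℤ} (hx : x ≤ p) (hy : p < y) (hp : a p = 0) (N : ℕ) :
    intervalSum (diagWeight a) N x y = 0 := by
  induction N generalizing y with
  | zero => simp [intervalSum, (hx.trans_lt hy).ne]
  | succ N ih =>
    rw [intervalSum, ih hy]
    by_cases h : p = y - 1
    · simp [diagWeight, ← h, hp]
    · rw [ih (by omega)]; simp

/-! ### Dual words and matching of the matrix entries -/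

/-- An index is admissible if and only if its entries are positive and its last entry, if any,
exceeds `1`. -/
theorem isAdmissibleIndex_iff {l : List ℕ} :
    IsAdmissibleIndex l ↔ (∀ x ∈ l, 1 ≤ x) ∧ ∀ x ∈ l.getLast?, 2 ≤ x := by
  constructor
  · intro h
    refine ⟨?_, ?_⟩
    · obtain ⟨L, hL, rfl⟩ := h
      intro x hx
      rw [List.mem_flatMap] at hx
      obtain ⟨p, -, hp⟩ := hx
      simp only [admissiblePiece, List.mem_append, List.mem_replicate, List.mem_singleton] at hp
      omega
    · intro x hx
      rw [Option.mem_def, List.getLast?_eq_some_iff] at hx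
      obtain ⟨l', rfl⟩ := hx
      simpa using SkewShape.two_le_last h (by simp)
  · -- split off the leading ones, up to the first entry larger than `1`
    suffices H : ∀ (l : List ℕ) (n : ℕ), (∀ x ∈ l, 1 ≤ x) → (∀ x ∈ l.getLast?, 2 ≤ x) →
        (l = [] → n = 0) → IsAdmissibleIndex (List.replicate n 1 ++ l) from
      fun h => H l 0 h.1 h.2 fun _ => rfl
    intro l
    induction l with
    | nil => intro n _ _ hn; exact ⟨[], by simp, by simp [hn rfl]⟩
    | cons x l ih =>
      intro n h1 h2 _
      have h1' : ∀ y ∈ l, 1 ≤ y := fun y hy => h1 y (by simp [hy])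
      have h2' : ∀ y ∈ l.getLast?, 2 ≤ y := by
        intro y hy
        refine h2 y ?_
        rw [Option.mem_def] at hy ⊢
        rw [List.getLast?_cons, hy]; rfl
      rcases (h1 x (by simp)).eq_or_lt with hx | hx
      · subst hx
        have hne : l ≠ [] := by
          rintro rfl
          have := h2 1 (by simp)
          omega
        have := ih (n + 1) h1' h2' (fun h => absurd h hne)
        rwa [List.replicate_succ', List.append_assoc] at this
      · obtain ⟨L, hL, hl⟩ := ih 0 h1' h2' (fun _ => rfl)
        refine ⟨(n + 1, x - 1) :: L, ?_, ?_⟩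
        · intro p hp
          rcases List.mem_cons.1 hp with rfl | hp
          · simp; omega
          · exact hL p hp
        · simp only [List.replicate_zero, List.nil_append] at hl
          simp only [List.flatMap_cons, admissiblePiece, ← hl, List.append_assoc]
          simp; omega

theorem isAdmissibleIndex_intervalWord {a : ℤ → ℕ} {x y : ℤ} (h1 : ∀ p, x ≤ p → p < y → 1 ≤ a p)
    (h2 : x < y → 2 ≤ a (y - 1)) : IsAdmissibleIndex (intervalWord a x y) := by
  rw [isAdmissibleIndex_iff]
  constructor
  · intro m hm
    obtain ⟨p, hx, hy, rfl⟩ := mem_intervalWord.1 hm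
    exact h1 p hx hy
  · rcases lt_or_ge x y with h | h
    · rw [intervalWord_succ a h]; simpa using h2 h
    · rw [intervalWord_of_le a h]; simp

theorem dualIndex_append {l₁ l₂ : List ℕ} (h₁ : IsAdmissibleIndex l₁) (h₂ : IsAdmissibleIndex l₂) :
    dualIndex (l₁ ++ l₂) = dualIndex l₂ ++ dualIndex l₁ := by
  obtain ⟨L₁, hL₁, rfl⟩ := h₁
  obtain ⟨L₂, hL₂, rfl⟩ := h₂
  rw [← List.flatMap_append, dualIndex, dualIndex, dualIndex, pieces_flatMap _ hL₁,
    pieces_flatMap _ hL₂, pieces_flatMap]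
  · simp
  · intro p hp
    rcases List.mem_append.1 hp with h | h
    · exact hL₁ p h
    · exact hL₂ p h

theorem isAdmissibleIndex_dualIndex {l : List ℕ} (h : IsAdmissibleIndex l) :
    IsAdmissibleIndex (dualIndex l) := by
  obtain ⟨L, hL, rfl⟩ := h
  refine ⟨_, ?_, rfl⟩
  rw [pieces_flatMap L hL]
  intro p hp
  simp only [List.mem_map, List.mem_reverse] at hp
  obtain ⟨q, hq, rfl⟩ := hp
  exact ⟨(hL q hq).2, (hL q hq).1⟩

theorem exists_int_antiderivative (f : ℤ → ℤ) : ∃ G : ℤ → ℤ, ∀ p, G (p + 1) = G p + f p := by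
  refine ⟨fun x => ∑ p ∈ Finset.Ico 0 x, f p - ∑ p ∈ Finset.Ico x 0, f p, fun p => ?_⟩
  rcases lt_or_ge p 0 with h | h
  · have h1 : Finset.Ico p 0 = insert p (Finset.Ico (p + 1) 0) := by ext q; simp; omega
    have h2 : Finset.Ico 0 (p + 1) = ∅ := by ext q; simp; omega
    have h3 : Finset.Ico 0 p = ∅ := by ext q; simp; omega
    simp only [h1, h2, h3]
    rw [Finset.sum_insert (by simp)]; simp
  · have h1 : Finset.Ico 0 (p + 1) = insert p (Finset.Ico 0 p) := by ext q; simp; omega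
    have h2 : Finset.Ico (p + 1) 0 = ∅ := by ext q; simp; omega
    have h3 : Finset.Ico p 0 = ∅ := by ext q; simp; omega
    simp only [h1, h2, h3]
    rw [Finset.sum_insert (by simp)]; simp; ring

/-- In terms of an antiderivative `G` of `a - 1`, the dual of the word on an interval has the
length `G y - G x`. -/
theorem length_dualIndex_intervalWord {a : ℤ → ℕ} {G : ℤ → ℤ}
    (hG : ∀ p, G (p + 1) = G p + ((a p - 1 : ℕ) : ℤ)) {x y : ℤ} (h : x ≤ y) :
    ((dualIndex (intervalWord a x y)).length : ℤ) = G y - G x := by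
  rw [length_dualIndex]
  induction y, h using Int.leInduction with
  | base => simp [intervalWord_of_le]
  | succ y h ih =>
    rw [intervalWord_succ a (show x < y + 1 by omega), List.map_append, List.sum_append,
      Nat.cast_add, add_sub_cancel_right, ih, hG]
    simp; ring

/-- Dual words give truncated sums with the same limit. -/
theorem exists_tendsto_intervalSum {a b : ℤ → ℕ} {x y x' y' : ℤ} (hxy : x ≤ y) (hxy' : x' ≤ y')
    (ha : IsAdmissibleIndex (intervalWord a x y))
    (hd : intervalWord b x' y' = dualIndex (intervalWord a x y)) :
    ∃ A : ℝ, Tendsto (fun N => intervalSum (diagWeight a) N x y) atTop (𝓝 A) ∧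
      Tendsto (fun N => intervalSum (diagWeight b) N x' y') atTop (𝓝 A) := by
  have hb : IsAdmissibleIndex (intervalWord b x' y') := hd ▸ isAdmissibleIndex_dualIndex ha
  have hpos := fun (c : ℤ → ℕ) (x y : ℤ) (hc : IsAdmissibleIndex (intervalWord c x y)) =>
    (isAdmissibleIndex_iff.1 hc).1
  refine ⟨(mzv (intervalWord a x y)).toReal, ?_, ?_⟩
  · simp_rw [intervalSum_eq_truncMZV hxy
      fun p h1 h2 => hpos a x y ha _ (mem_intervalWord.2 ⟨p, h1, h2, rfl⟩)]
    exact tendsto_truncMZV ha (hpos a x y ha)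
  · simp_rw [intervalSum_eq_truncMZV hxy'
      fun p h1 h2 => hpos b x' y' hb _ (mem_intervalWord.2 ⟨p, h1, h2, rfl⟩)]
    rw [← mzv_dualIndex ha, ← hd]
    exact tendsto_truncMZV hb (hpos b x' y' hb)

/-- The data of a tableau and of its dual, in terms of diagonals. Column `j` of the tableau is the
word of `a` on `u j ≤ p < v j`, and the dual of column `j` is the word of `b` on `ut j ≤ q < vt
j`. Either the columns `j` and `j + 1` have a row in common, that is `u j ≤ v (j + 1)`, and then
so do their duals, with the overlap given by the dual of the common pieces; or both the two
columns and their duals are separated by a diagonal without boxes. -/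
structure IsDualChain (s : ℕ) (u v ut vt : ℕ → ℤ) (a b : ℤ → ℕ) : Prop where
  le : ∀ j, j < s → u j ≤ v j
  anti_left : ∀ j, j + 1 < s → u (j + 1) < u j
  anti_right : ∀ j, j + 1 < s → v (j + 1) < v j
  pos : ∀ j, j < s → ∀ p, u j ≤ p → p < v j → 1 ≤ a p
  last : ∀ j, j < s → u j < v j → 2 ≤ a (v j - 1)
  le' : ∀ j, j < s → ut j ≤ vt j
  word : ∀ j, j < s → intervalWord b (ut j) (vt j) = dualIndex (intervalWord a (u j) (v j))
  mono_left : ∀ j, j + 1 < s → ut j < ut (j + 1)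
  mono_right : ∀ j, j + 1 < s → vt j < vt (j + 1)
  adj : ∀ j, j + 1 < s → u j ≤ v (j + 1) → 2 ≤ a (u j - 1) ∧
    ut (j + 1) = vt j - (dualIndex (intervalWord a (u j) (v (j + 1)))).length
  gap : ∀ j, j + 1 < s → v (j + 1) < u j → a (v (j + 1)) = 0 ∧ b (vt j) = 0 ∧ ut (j + 1) = vt j + 1

namespace IsDualChain
variable {s : ℕ} {u v ut vt : ℕ → ℤ} {a b : ℤ → ℕ}

theorem chain_le {f : ℕ → ℤ} (hf : ∀ j, j + 1 < s → f j < f (j + 1)) {i j : ℕ} (h : i ≤ j)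
    (hj : j < s) : f i ≤ f j := by
  induction j, h using Nat.le_induction with
  | base => rfl
  | succ j h ih => exact (ih (by omega)).trans (hf j hj).le

theorem chain_ge {f : ℕ → ℤ} (hf : ∀ j, j + 1 < s → f (j + 1) < f j) {i j : ℕ} (h : i ≤ j)
    (hj : j < s) : f j ≤ f i := by
  have := chain_le (f := fun j => - f j) (fun j hj => neg_lt_neg (hf j hj)) h hj
  simpa using this

theorem length_eq (h : IsDualChain s u v ut vt a b) {G : ℤ → ℤ}
    (hG : ∀ p, G (p + 1) = G p + ((a p - 1 : ℕ) : ℤ)) {j : ℕ} (hj : j < s) :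
    vt j - ut j = G (v j) - G (u j) := by
  rw [← length_dualIndex_intervalWord hG (h.le j hj), ← h.word j hj, length_intervalWord]
  have := h.le' j hj
  omega

/-- Within a run of columns of which neighbours have a row in common, `vt j + G (u j)` is
constant. So the dual of the interval from `x` to `y`, with `x` and `y` at ends of pieces, goes
from `C - G y` to `C - G x`. -/
theorem potential (h : IsDualChain s u v ut vt a b) {G : ℤ → ℤ}
    (hG : ∀ p, G (p + 1) = G p + ((a p - 1 : ℕ) : ℤ)) {i j : ℕ}
    (hij : i ≤ j) (hj : j < s) (hno : ∀ k, i ≤ k → k < j → u k ≤ v (k + 1)) :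
    vt j + G (u j) = vt i + G (u i) := by
  induction j, hij using Nat.le_induction with
  | base => rfl
  | succ j hij ih =>
    have h1 := ih (by omega) fun k h1 h2 => hno k h1 (by omega)
    have h2 := hno j hij (by omega)
    have h3 := (h.adj j hj h2).2
    rw [length_dualIndex_intervalWord hG h2] at h3
    have h4 := h.length_eq hG hj
    omega

/-- The word from the top of column `i` to the bottom of a column `j ≤ i` of the same run is
admissible, and `b` carries its dual from the top of the dual of `j` to the bottom of the dual of
`i`. -/
theorem dualIndex_intervalWord_of_ge (h : IsDualChain s u v ut vt a b) {i j : ℕ}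
    (hji : j ≤ i) (hi : i < s) (hno : ∀ k, j ≤ k → k < i → u k ≤ v (k + 1)) :
    (∀ p, u i ≤ p → p < v j → 1 ≤ a p) ∧ (u i < v j → 2 ≤ a (v j - 1)) ∧
      intervalWord b (ut j) (vt i) = dualIndex (intervalWord a (u i) (v j)) := by
  induction i, hji using Nat.le_induction with
  | base => exact ⟨h.pos j hi, h.last j hi, h.word j hi⟩
  | succ i hji ih =>
    obtain ⟨hp, hl, hd⟩ := ih (by omega) fun k h1 h2 => hno k h1 (by omega)
    obtain ⟨G, hG⟩ := exists_int_antiderivative fun p => ((a p - 1 : ℕ) : ℤ)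
    have h2 := hno i hji (by omega)
    obtain ⟨h3, h4⟩ := h.adj i hi h2
    have hu := h.anti_left i hi
    have huv : u i ≤ v j := (chain_ge h.anti_left hji (by omega)).trans (h.le j (by omega))
    have hne : u j < v j := by
      have := hno j le_rfl (by omega)
      have := h.anti_right j (by omega)
      omega
    have hlast := h.last j (by omega) hne
    have hp1 : ∀ p, u (i + 1) ≤ p → p < u i → 1 ≤ a p := fun p q1 q2 =>
      h.pos (i + 1) hi p q1 (by omega)
    have ha1 : IsAdmissibleIndex (intervalWord a (u (i + 1)) (u i)) :=
      isAdmissibleIndex_intervalWord hp1 fun _ => h3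
    have ha2 : IsAdmissibleIndex (intervalWord a (u i) (v j)) :=
      isAdmissibleIndex_intervalWord hp fun _ => hlast
    have ha3 : IsAdmissibleIndex (intervalWord a (u i) (v (i + 1))) :=
      isAdmissibleIndex_intervalWord (fun p q1 q2 => h.pos (i + 1) hi p (by omega) q2)
        fun _ => h.last (i + 1) hi (by omega)
    refine ⟨fun p q1 q2 => ?_, fun _ => hlast, ?_⟩
    · rcases lt_or_ge p (u i) with q | q
      · exact hp1 p q1 q
      · exact hp p q q2
    · have hw := h.word (i + 1) hi
      rw [← intervalWord_append a hu.le h2, dualIndex_append ha1 ha3] at hw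
      have hpot := h.potential hG (show i ≤ i + 1 by omega) hi fun k q1 q2 => by
        obtain rfl : k = i := by omega
        exact h2
      have hlen := length_dualIndex_intervalWord hG hu.le
      have hm := h.mono_right i hi
      have hd2 := (intervalWord_eq_append hw (y := vt i) (by omega) hm.le (Or.inr (by omega))).2
      have hut : ut j ≤ vt i :=
        (h.le' j (by omega)).trans (chain_le h.mono_right hji (by omega))
      rw [← intervalWord_append a hu.le huv, dualIndex_append ha1 ha2, hd2, ← hd,
        intervalWord_append b hut hm.le]

/-- For columns `i < j` of the same run, the interval from the top of `i` to the bottom of `j` is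
an initial part of column `i`, made up of whole pieces, or is reversed; the dual interval behaves
alike. -/
theorem dualIndex_intervalWord_of_lt (h : IsDualChain s u v ut vt a b) {i j : ℕ}
    (hij : i < j) (hj : j < s) (hno : ∀ k, i ≤ k → k < j → u k ≤ v (k + 1)) :
    (v j < u i ∧ vt i < ut j) ∨
    (u i ≤ v j ∧ ut j ≤ vt i ∧ IsAdmissibleIndex (intervalWord a (u i) (v j)) ∧
      intervalWord b (ut j) (vt i) = dualIndex (intervalWord a (u i) (v j))) := by
  obtain ⟨G, hG⟩ := exists_int_antiderivative fun p => ((a p - 1 : ℕ) : ℤ)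
  have hpot := h.potential hG hij.le hj hno
  have hlen := h.length_eq hG hj
  have hmono : Monotone G := by
    refine monotone_int_of_le_succ fun p => ?_
    rw [hG]; omega
  rcases lt_or_ge (v j) (u i) with hlt | hge
  · refine Or.inl ⟨hlt, ?_⟩
    have h1 := (h.adj i (by omega) (hno i le_rfl hij)).1
    have h2 := hG (u i - 1)
    rw [sub_add_cancel] at h2
    have h3 := hmono (show v j ≤ u i - 1 by omega)
    omega
  · have hlen' := length_dualIndex_intervalWord hG hge
    have hvv : v j < v i := by
      have := chain_ge h.anti_right (show i + 1 ≤ j from hij) hj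
      have := h.anti_right i (by omega)
      omega
    have huu : u j < u i := by
      have := chain_ge h.anti_left (show i + 1 ≤ j from hij) hj
      have := h.anti_left i (by omega)
      omega
    have hut := chain_le h.mono_left hij.le hj
    have ha1 : IsAdmissibleIndex (intervalWord a (u i) (v j)) :=
      isAdmissibleIndex_intervalWord (fun p q1 q2 => h.pos i (by omega) p q1 (by omega))
        fun _ => h.last j hj (by omega)
    have ha2 : IsAdmissibleIndex (intervalWord a (v j) (v i)) :=
      isAdmissibleIndex_intervalWord (fun p q1 q2 => h.pos i (by omega) p (by omega) q2)
        fun _ => h.last i (by omega) (by omega)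
    have hw := h.word i (by omega)
    rw [← intervalWord_append a hge hvv.le, dualIndex_append ha1 ha2] at hw
    exact Or.inr ⟨hge, by omega, ha1,
      ((intervalWord_eq_append hw (y := ut j) hut (by omega) (Or.inr (by omega))).2).symm⟩

/-- The entries `(j, i)` of the Jacobi–Trudi matrix of a tableau and `(i, j)` of that of its dual,
with columns numbered as in `IsDualChain`, have the same limit. -/
theorem exists_tendsto (h : IsDualChain s u v ut vt a b) {i j : ℕ} (hi : i < s) (hj : j < s) :
    ∃ A : ℝ, Tendsto (fun N => intervalSum (diagWeight a) N (u i) (v j)) atTop (𝓝 A) ∧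
      Tendsto (fun N => intervalSum (diagWeight b) N (ut j) (vt i)) atTop (𝓝 A) := by
  have hzero : (∀ N, intervalSum (diagWeight a) N (u i) (v j) = 0) →
      (∀ N, intervalSum (diagWeight b) N (ut j) (vt i) = 0) →
      ∃ A : ℝ, Tendsto (fun N => intervalSum (diagWeight a) N (u i) (v j)) atTop (𝓝 A) ∧
      Tendsto (fun N => intervalSum (diagWeight b) N (ut j) (vt i)) atTop (𝓝 A) := by
    intro h1 h2
    refine ⟨0, ?_, ?_⟩
    · simp_rw [h1]; exact tendsto_const_nhds
    · simp_rw [h2]; exact tendsto_const_nhds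
  rcases le_or_gt j i with hji | hij
  · by_cases hno : ∀ k, j ≤ k → k < i → u k ≤ v (k + 1)
    · obtain ⟨hp, hl, hd⟩ := h.dualIndex_intervalWord_of_ge hji hi hno
      exact exists_tendsto_intervalSum ((chain_ge h.anti_left hji hi).trans (h.le j hj))
        ((h.le' j hj).trans (chain_le h.mono_right hji hi)) (isAdmissibleIndex_intervalWord hp hl) hd
    · -- both intervals contain a diagonal without boxes
      push Not at hno
      obtain ⟨k, hjk, hki, hk⟩ := hno
      obtain ⟨ha, hb, -⟩ := h.gap k (by omega) hk
      refine hzero (fun N => intervalSum_eq_zero ?_ ?_ ha N) (fun N => intervalSum_eq_zero ?_ ?_ hb N)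
      · exact (chain_ge h.anti_left hki hi).trans (h.le (k + 1) (by omega))
      · exact hk.trans_le ((h.le k (by omega)).trans (chain_ge h.anti_right hjk (by omega)))
      · exact (h.le' j hj).trans (chain_le h.mono_right hjk (by omega))
      · exact (h.mono_right k (by omega)).trans_le (chain_le h.mono_right hki hi)
  · by_cases hno : ∀ k, i ≤ k → k < j → u k ≤ v (k + 1)
    · rcases h.dualIndex_intervalWord_of_lt hij hj hno with ⟨h1, h2⟩ | ⟨h1, h2, h3, h4⟩
      · exact hzero (fun N => intervalSum_of_lt _ N h1) (fun N => intervalSum_of_lt _ N h2)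
      · exact exists_tendsto_intervalSum h1 h2 h3 h4
    · -- both intervals are reversed
      push Not at hno
      obtain ⟨k, hik, hkj, hk⟩ := hno
      obtain ⟨-, -, hg⟩ := h.gap k (by omega) hk
      have h1 := chain_ge h.anti_right (show k + 1 ≤ j from hkj) hj
      have h2 := chain_ge h.anti_left hik (by omega)
      have h3 := chain_le h.mono_left (show k + 1 ≤ j from hkj) hj
      have h4 := chain_le h.mono_right hik (by omega)
      exact hzero (fun N => intervalSum_of_lt _ N (by omega)) (fun N => intervalSum_of_lt _ N (by omega))

end IsDualChain

/-! ### The dual tableau -/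

namespace SkewShape

theorem length_column {δ : SkewShape} {X : Type} (k : δ.Tableau X) (j : ℕ) :
    (column k j).length = δ.bot j - δ.top j := by simp [column]

theorem column_eq_intervalWord {δ : SkewShape} {k : δ.Tableau ℕ} {a : ℤ → ℕ}
    (ha : ∀ c : δ.Cell, k c = a ((c.1.1 : ℤ) - c.1.2)) (j : ℕ) :
    column k j = intervalWord a ((δ.top j : ℤ) - j) ((δ.bot j : ℤ) - j) := by
  refine List.ext_getElem ?_ fun n h1 h2 => ?_
  · rw [length_column, length_intervalWord]; omega
  · simp only [column, List.getElem_ofFn, intervalWord, List.getElem_map, List.getElem_range, ha]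
    congr 1; push_cast; ring

theorem col_lt_numCols (δ : SkewShape) (c : ℕ × ℕ) (hc : c ∈ δ.cells) : c.2 < δ.numCols := by
  have h : c ∈ δ.outer.cells := (Finset.mem_sdiff.1 hc).1
  have h1 : c.2 < δ.outer.rowLen c.1 := YoungDiagram.mem_iff_lt_rowLen.1 h
  exact h1.trans_le (δ.outer.rowLen_anti _ _ (Nat.zero_le _))

theorem colLen_diagramOfCols {s : ℕ} {f : ℕ → ℕ} (hf : Monotone f) {d : ℕ} (hd : d < s) :
    (diagramOfCols s f hf).colLen d = f (s - 1 - d) := by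
  refine eq_of_forall_lt_iff fun i => ?_
  rw [← YoungDiagram.mem_iff_lt_colLen, mem_diagramOfCols]
  exact and_iff_right hd

section
variable {δ : SkewShape} {k : δ.Tableau ℕ}

theorem top_dualShape (hk : IsAdmissible k) {d : ℕ} (hd : d < δ.numCols) :
    (dualShape k hk).top d = dualTop k (δ.numCols - 1 - d) :=
  colLen_diagramOfCols (dualTop_mono hk) hd

theorem bot_dualShape (hk : IsAdmissible k) {d : ℕ} (hd : d < δ.numCols) :
    (dualShape k hk).bot d =
      dualTop k (δ.numCols - 1 - d) + dualHeight k (δ.numCols - 1 - d) :=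
  colLen_diagramOfCols (dualBot_mono hk) hd

theorem column_dualTableau (hk : IsAdmissible k) {d : ℕ} (hd : d < δ.numCols) :
    column (dualTableau k hk) d = dualIndex (column k (δ.numCols - 1 - d)) := by
  refine List.ext_getElem ?_ fun n h1 h2 => ?_
  · rw [length_column, top_dualShape hk hd, bot_dualShape hk hd, dualHeight]; omega
  · simp only [column, List.getElem_ofFn, dualTableau, top_dualShape hk hd]
    congr 1; simp

theorem IsAdmissible.one_le (hk : IsAdmissible k) (c : δ.Cell) : 1 ≤ k c := by
  obtain ⟨⟨i, j⟩, hc⟩ := c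
  have h := (δ.mem_cells _ _).1 hc
  refine (isAdmissibleIndex_iff.1 (hk.col_admissible j)).1 _ ?_
  rw [column, List.mem_ofFn]
  refine ⟨⟨i - δ.top j, by omega⟩, ?_⟩
  congr 3; simp; omega

theorem one_le_dualTableau (hk : IsAdmissible k) (c : (dualShape k hk).Cell) :
    1 ≤ dualTableau k hk c :=
  (isAdmissibleIndex_iff.1 (isAdmissibleIndex_dualIndex (hk.col_admissible _))).1 _
    (List.getElem_mem _)

/-- The entry on the diagonal just before the top of a column that meets the next one: since it
exceeds `1`, the top of the column is the beginning of a piece of the next column too. -/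
theorem IsAdmissible.two_le_left (hk : IsAdmissible k) {a : ℤ → ℕ}
    (ha : ∀ c : δ.Cell, k c = a ((c.1.1 : ℤ) - c.1.2)) {j : ℕ} (h : δ.top j < δ.bot (j + 1)) :
    2 ≤ a ((δ.top j : ℤ) - j - 1) := by
  have hb := δ.bot_anti (show j ≤ j + 1 by omega)
  have ht := δ.top_anti (show j ≤ j + 1 by omega)
  have hc : (δ.top j, j) ∈ δ.cells := (δ.mem_cells _ _).2 (by omega)
  have hd : (δ.top j, j + 1) ∈ δ.cells := (δ.mem_cells _ _).2 (by omega)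
  have h1 := hk.right_of_top ⟨_, hc⟩ ⟨_, hd⟩ rfl rfl
  have h2 := hk.one_le ⟨_, hd⟩
  have h3 := ha ⟨_, hd⟩
  have h4 : (δ.top j : ℤ) - j - 1 = (δ.top j : ℤ) - (j + 1 : ℕ) := by push_cast; ring
  rw [h4, ← h3]; omega

theorem IsAdmissible.one_le_diag (hk : IsAdmissible k) {a : ℤ → ℕ}
    (ha : ∀ c : δ.Cell, k c = a ((c.1.1 : ℤ) - c.1.2)) {j : ℕ} {p : ℤ}
    (h1 : (δ.top j : ℤ) - j ≤ p) (h2 : p < (δ.bot j : ℤ) - j) : 1 ≤ a p := by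
  have hc : ((p + j).toNat, j) ∈ δ.cells := (δ.mem_cells _ _).2 (by omega)
  have h3 := ha ⟨_, hc⟩
  have h4 := hk.one_le ⟨_, hc⟩
  simp only at h3
  rw [h3, show (((p + j).toNat : ℤ)) - j = p by omega] at h4
  exact h4

theorem IsAdmissible.two_le_bottom (hk : IsAdmissible k) {a : ℤ → ℕ}
    (ha : ∀ c : δ.Cell, k c = a ((c.1.1 : ℤ) - c.1.2)) {j : ℕ} (h : δ.top j < δ.bot j) :
    2 ≤ a ((δ.bot j : ℤ) - j - 1) := by
  have h1 := (isAdmissibleIndex_iff.1 (hk.col_admissible j)).2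
  rw [column_eq_intervalWord ha, intervalWord_succ a (by omega)] at h1
  simpa using h1

/-- The word `l` which neighbouring columns with a common row share: it ends column `j + 1` and
begins column `j`, so its dual begins the dual of column `j + 1` and ends that of column `j`. -/
theorem IsAdmissible.exists_common_pieces (hk : IsAdmissible k) {a : ℤ → ℕ}
    (ha : ∀ c : δ.Cell, k c = a ((c.1.1 : ℤ) - c.1.2)) {j : ℕ} (h : δ.top j < δ.bot (j + 1)) :
    ∃ l, l = intervalWord a ((δ.top j : ℤ) - j) ((δ.bot (j + 1) : ℤ) - (j + 1 : ℕ)) ∧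
      dualTop k (j + 1) + (dualIndex l).length + 1 = dualTop k j + dualHeight k j ∧
      (∃ l', dualIndex (column k j) = l' ++ dualIndex l) ∧
      ∃ l', dualIndex (column k (j + 1)) = dualIndex l ++ l' := by
  have hb := δ.bot_anti (show j ≤ j + 1 by omega)
  have ht := δ.top_anti (show j ≤ j + 1 by omega)
  set x : ℤ := (δ.top j : ℤ) - j with hx
  set y : ℤ := (δ.bot (j + 1) : ℤ) - (j + 1 : ℕ) with hy
  have hcol := column_eq_intervalWord ha j
  have hcol' := column_eq_intervalWord ha (j + 1)
  have h1 := intervalWord_append a (show x ≤ y by omega) (show y ≤ (δ.bot j : ℤ) - j by omega)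
  have h2 := intervalWord_append a (show (δ.top (j + 1) : ℤ) - (j + 1 : ℕ) ≤ x by omega)
    (show x ≤ y by omega)
  have hpre : IsAdmissibleIndex (intervalWord a x y) := by
    refine isAdmissibleIndex_intervalWord (fun p q1 q2 => hk.one_le_diag ha q1 (by omega)) ?_
    intro _
    exact hk.two_le_bottom ha (by omega)
  have hrest : IsAdmissibleIndex (intervalWord a y ((δ.bot j : ℤ) - j)) := by
    refine isAdmissibleIndex_intervalWord (fun p q1 q2 => hk.one_le_diag ha (by omega) q2) ?_
    intro _
    exact hk.two_le_bottom ha (by omega)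
  have hfront : IsAdmissibleIndex (intervalWord a ((δ.top (j + 1) : ℤ) - (j + 1 : ℕ)) x) := by
    refine isAdmissibleIndex_intervalWord (fun p q1 q2 => hk.one_le_diag ha q1 (by omega)) ?_
    intro _
    exact hk.two_le_left ha h
  refine ⟨intervalWord a x y, rfl, ?_,
    ⟨_, (congrArg dualIndex (hcol.trans h1.symm)).trans (dualIndex_append hpre hrest)⟩,
    ⟨_, (congrArg dualIndex (hcol'.trans h2.symm)).trans (dualIndex_append hfront hpre)⟩⟩
  have h3 := overlap_le_height hk j
  have h4 : (column k j).take (δ.bot (j + 1) - δ.top j - 1) = intervalWord a x y := by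
    rw [hcol, ← h1, List.take_left' (by rw [length_intervalWord]; omega)]
  have h5 : dualOverlap k j = (dualIndex (intervalWord a x y)).length + 1 := by
    rw [dualOverlap, if_pos h, h4]
  simp only [dualTop]
  omega

theorem dualTop_succ_of_le (k : δ.Tableau ℕ) {j : ℕ} (h : δ.bot (j + 1) ≤ δ.top j) :
    dualTop k (j + 1) = dualTop k j + dualHeight k j := by
  simp [dualTop, dualOverlap, not_lt.2 h]

/-- The duals of neighbouring columns agree on the diagonals that they share. A diagonal of the
dual shape is numbered by `q`, the row plus the number `j` of the column of `δ`. -/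
theorem dualIndex_column_succ (hk : IsAdmissible k) {j q : ℕ}
    (h1 : dualTop k (j + 1) + (j + 1) ≤ q) (h2 : q < dualTop k j + dualHeight k j + j) :
    (dualIndex (column k (j + 1)))[q - (j + 1) - dualTop k (j + 1)]? =
      (dualIndex (column k j))[q - j - dualTop k j]? := by
  obtain ⟨a, ha, -⟩ := exists_diagonal_function hk.diag
  have h : δ.top j < δ.bot (j + 1) := by
    by_contra hc
    have := dualTop_succ_of_le k (not_lt.1 hc)
    omega
  obtain ⟨l, -, hl, ⟨l₁, hl₁⟩, l₂, hl₂⟩ := hk.exists_common_pieces ha h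
  have hlen : dualHeight k j = l₁.length + (dualIndex l).length := by
    rw [dualHeight, hl₁, List.length_append]
  rw [hl₁, hl₂, List.getElem?_append_left (by omega), List.getElem?_append_right (by omega)]
  congr 1; omega

theorem dualIndex_column_eq (hk : IsAdmissible k) {i j q : ℕ} (hij : i ≤ j)
    (h1 : dualTop k j + j ≤ q) (h2 : q < dualTop k i + dualHeight k i + i) :
    (dualIndex (column k j))[q - j - dualTop k j]? =
      (dualIndex (column k i))[q - i - dualTop k i]? := by
  induction j, hij using Nat.le_induction with
  | base => rfl
  | succ j hij ih =>
    have h3 := dualTop_mono hk (show j ≤ j + 1 by omega)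
    have h4 := dualBot_mono hk hij
    simp only at h4
    rw [dualIndex_column_succ hk h1 (by omega), ih (by omega)]

/-- The dual tableau is constant along the diagonals, too. -/
theorem dualTableau_diag (hk : IsAdmissible k) (c d : (dualShape k hk).Cell)
    (h : c.1.2 + d.1.1 = d.1.2 + c.1.1) : dualTableau k hk c = dualTableau k hk d := by
  wlog hcd : d.1.2 ≤ c.1.2 generalizing c d
  · exact (this d c h.symm (by omega)).symm
  have hc := (mem_dualShape k hk c.1.1 c.1.2).1 c.2
  have hd := (mem_dualShape k hk d.1.1 d.1.2).1 d.2
  have h1 := dualIndex_column_eq hk (i := δ.numCols - 1 - c.1.2) (j := δ.numCols - 1 - d.1.2)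
    (q := c.1.1 + (δ.numCols - 1 - c.1.2)) (by omega) (by omega) (by omega)
  rw [show c.1.1 + (δ.numCols - 1 - c.1.2) - (δ.numCols - 1 - d.1.2) = d.1.1 by omega,
    show c.1.1 + (δ.numCols - 1 - c.1.2) - (δ.numCols - 1 - c.1.2) = c.1.1 by omega,
    List.getElem?_eq_getElem (by rw [← dualHeight]; omega),
    List.getElem?_eq_getElem (by rw [← dualHeight]; omega)] at h1
  exact (Option.some.inj h1).symm

theorem IsAdmissible.isDualChain (hk : IsAdmissible k) {a b : ℤ → ℕ}
    (ha : ∀ c : δ.Cell, k c = a ((c.1.1 : ℤ) - c.1.2))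
    (ha0 : ∀ p, (∀ c : δ.Cell, (c.1.1 : ℤ) - c.1.2 ≠ p) → a p = 0)
    (hb : ∀ c : (dualShape k hk).Cell, dualTableau k hk c = b ((c.1.1 : ℤ) - c.1.2))
    (hb0 : ∀ p, (∀ c : (dualShape k hk).Cell, (c.1.1 : ℤ) - c.1.2 ≠ p) → b p = 0) :
    IsDualChain δ.numCols (fun j => (δ.top j : ℤ) - j) (fun j => (δ.bot j : ℤ) - j)
      (fun j => (dualTop k j : ℤ) + j - (δ.numCols - 1))
      (fun j => ((dualTop k j + dualHeight k j : ℕ) : ℤ) + j - (δ.numCols - 1)) a b where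
  le j _ := by have := δ.top_le_bot j; omega
  anti_left j _ := by have := δ.top_anti (show j ≤ j + 1 by omega); omega
  anti_right j _ := by have := δ.bot_anti (show j ≤ j + 1 by omega); omega
  pos j _ p h1 h2 := hk.one_le_diag ha h1 h2
  last j _ h := hk.two_le_bottom ha (by omega)
  le' j _ := by omega
  word j hj := by
    have h1 := column_eq_intervalWord hb (δ.numCols - 1 - j)
    have hd : δ.numCols - 1 - j < δ.numCols := by omega
    rw [column_dualTableau hk hd, top_dualShape hk hd, bot_dualShape hk hd,
      show δ.numCols - 1 - (δ.numCols - 1 - j) = j by omega, column_eq_intervalWord ha] at h1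
    rw [h1]
    congr 1 <;> omega
  mono_left j _ := by have := dualTop_mono hk (show j ≤ j + 1 by omega); omega
  mono_right j _ := by have := dualBot_mono hk (show j ≤ j + 1 by omega); simp only at this; omega
  adj j _ h := by
    have h1 : δ.top j < δ.bot (j + 1) := by omega
    refine ⟨hk.two_le_left ha h1, ?_⟩
    obtain ⟨l, hl, h2, -⟩ := hk.exists_common_pieces ha h1
    rw [← hl]; omega
  gap j _ h := by
    have h1 : δ.bot (j + 1) ≤ δ.top j := by omega
    have h2 := dualTop_succ_of_le k h1
    refine ⟨ha0 _ ?_, hb0 _ ?_, by omega⟩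
    · rintro ⟨⟨r, m⟩, hc⟩
      have h3 := (δ.mem_cells _ _).1 hc
      simp only
      rcases le_or_gt m j with hm | hm
      · have := δ.top_anti hm; omega
      · have := δ.bot_anti (show j + 1 ≤ m from hm); omega
    · rintro ⟨⟨r, d⟩, hc⟩
      have h3 := (mem_dualShape k hk r d).1 hc
      simp only
      rcases le_or_gt (δ.numCols - 1 - d) j with hm | hm
      · have := dualBot_mono hk hm; simp only at this; omega
      · have := dualTop_mono hk (show j + 1 ≤ δ.numCols - 1 - d from hm); omega

end

end SkewShape

theorem theorem3p2 (δ : SkewShape) (k : δ.Tableau ℕ) (hk : SkewShape.IsAdmissible k) :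
    Summable (SkewShape.zetaTerm k) ∧
    Summable (SkewShape.zetaTerm (SkewShape.dualTableau k hk)) ∧
    SkewShape.schurZeta k = SkewShape.schurZeta (SkewShape.dualTableau k hk) := by
  obtain ⟨a, ha, ha0⟩ := SkewShape.exists_diagonal_function hk.diag
  obtain ⟨b, hb, hb0⟩ := SkewShape.exists_diagonal_function (SkewShape.dualTableau_diag hk)
  have hchain := hk.isDualChain ha ha0 hb hb0
  -- `A i j` is the common limit; the matrix of `k` is the transpose of `A`, and that of the dual is
  -- `A` with rows and columns in reverse order, because dual columns are arranged from right to left.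
  choose A hA hA' using fun i j : Fin δ.numCols => hchain.exists_tendsto i.2 j.2
  have h1 := SkewShape.hasSum_zetaTerm δ.col_lt_numCols ha hk.one_le (Matrix.of A).transpose
    fun i j => hA j i
  have h2 := SkewShape.hasSum_zetaTerm (s := δ.numCols)
    (fun c hc => ((SkewShape.mem_dualShape k hk c.1 c.2).1 hc).1) hb
    (SkewShape.one_le_dualTableau hk) ((Matrix.of A).submatrix Fin.revPerm Fin.revPerm) (by
      intro i j
      have h : Tendsto _ _ (𝓝 ((Matrix.of A).submatrix Fin.revPerm Fin.revPerm i j)) := hA' i.rev j.rev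
      simp only [Fin.val_rev] at h
      rw [SkewShape.top_dualShape hk j.2, SkewShape.bot_dualShape hk i.2]
      have e : ∀ i : Fin δ.numCols, δ.numCols - (i + 1 : ℕ) = δ.numCols - 1 - i := fun i => by omega
      simp only [e] at h
      convert h using 3 <;> omega)
  rw [Matrix.det_transpose] at h1
  rw [Matrix.det_submatrix_equiv_self] at h2
  exact ⟨h1.summable, h2.summable, h1.tsum_eq.trans h2.tsum_eq.symm⟩
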